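/- Fix a positive integer $n$. A *word* is a sequence $u = u_1 u_2 \cdots u_n$ of positive integers, with positions (*sites*) in $\mathbb{Z}/n\mathbb{Z}$. Its *type* is the sequence $\mathbf m=(m_1,m_2,\ldots)$, where $m_j$ is the number of occurrences of $j$ in $u$; put $p_i(\mathbf m)=m_1+\cdots+m_i$. If $\ell$ is the largest letter of $u$, then $u$ has $\ell$ *classes*, and $u$ is *packed* if each of $1,\ldots,\ell$ occurs in it. For $i\ge 1$, $\vee_i u$ is obtained from $u$ by decreasing by $1$ every letter larger than $i$, and $\vee_i\mathbf m=(m_1,\ldots,m_{i-1},m_i+m_{i+1},m_{i+2},\ldots)$. For a finite set $T=\{t_1<\cdots<t_k\}$ of positive integers, $\bigvee_T=\vee_{t_1}\cdots\vee_{t_k}$ (so $\vee_{t_k}$ is applied first), on words and on types. A *queue* is a set $q$ of sites. It maps a word $u$ to the word $v=q(u)$ computed as follows. Order the sites as $i_1,\ldots,i_n$ so that $u_{i_1}\le\cdots\le u_{i_n}$ (the result does not depend on the choice). Phase I: for $i=i_n,i_{n-1},\ldots,i_{|q|+1}$ in this order, find the first site $j$ weakly to the left (cyclically) of $i$ such that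 $j\notin q$ and $v_j$ is not yet set, and set $v_j=u_i+1$. Phase II: for $i=i_1,\ldots,i_{|q|}$ in this order, find the first site $j$ weakly to the right (cyclically) of $i$ such that $j\in q$ and $v_j$ is not yet set, and set $v_j=u_i$. For a packed word $u$ of type $\mathbf m$ with $\ell$ classes, the *spectral weight* of $u$ is the polynomial $$\langle u\rangle=\sum_{(q_1,\ldots,q_{\ell-1})}\ \prod_{i=1}^{\ell-1}\ \prod_{s\in q_i}x_s\ \in\ \mathbb{Z}[x_1,\ldots,x_n],$$ where the sum is over all sequences of queues with $|q_i|=p_i(\mathbf m)$ for all $i$ and $q_{\ell-1}(\cdots q_2(q_1(1^n))\cdots)=u$, with $1^n=11\cdots1$. Let $e_k$ denote the $k$-th elementary symmetric polynomial. **Corollary.** Let $T$ be a finite set of positive integers, and let $\mathbf m$ be a type such that $m_t\neq 0$ and $m_{t+1}\neq 0$ for every $t\in T$. Let $v$ be a packed word of type $\bigvee_T\mathbf m$. Then $$\langle v\rangle\prod_{t\in T}e_{p_t(\mathbf m)}(x_1,\ldots,x_n)=\sum_u\langle u\rangle,$$ where the sum is over all words $u$ of type $\mathbf m$ such that $\bigvee_T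 u=v$. -/

import Mathlib

namespace MLQ

/-- The words `u = u₁ ⋯ uₙ` in the alphabet of positive integers, with letters indexed by the
sites, which are the elements of `ℤ/nℤ`. -/
abbrev Word (n : ℕ) : Type := ZMod n → ℕ+

/-- A queue is a set of sites. -/
abbrev Queue (n : ℕ) : Type := Finset (ZMod n)

/-- Vectors `(m₁, m₂, …)` of nonnegative integers. -/
abbrev TypeVec : Type := ℕ+ → ℕ

/-- The partial sum `p_i(m) = m₁ + ⋯ + m_i`. -/
def partialSum (m : TypeVec) (i : ℕ+) : ℕ := ∑ j ∈ Finset.Icc 1 i, m j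

/-- Merging of the classes `i` and `i + 1` in a vector `m`: the vector
`(m₁, …, m_{i-1}, m_i + m_{i+1}, m_{i+2}, …)`. -/
def mergeType (i : ℕ+) (m : TypeVec) : TypeVec := fun j =>
  if j < i then m j else if j = i then m i + m (i + 1) else m (j + 1)

/-- For `T = {t₁ < ⋯ < t_k}`, the vector `∨_{t₁} (⋯ (∨_{t_k} m))`. -/
def mergeTypeSet (T : Finset ℕ+) (m : TypeVec) : TypeVec :=
  (T.sort (· ≤ ·)).foldr mergeType m

section Sites

variable {n : ℕ}

/-- Merging of the classes `i` and `i + 1` in a word: all letters larger than `i` are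
decreased by one. -/
def merge (i : ℕ+) (u : Word n) : Word n := fun s => if i < u s then u s - 1 else u s

/-- For `T = {t₁ < ⋯ < t_k}`, the word `∨_{t₁} (⋯ (∨_{t_k} u))`. -/
def mergeSet (T : Finset ℕ+) (u : Word n) : Word n :=
  (T.sort (· ≤ ·)).foldr merge u

/-- The sites listed in a weakly increasing order of their letters in `u` (ties are broken by
the position in `0, 1, …, n - 1`; the word `q(u)` below does not depend on this choice). -/
def siteOrder (u : Word n) : List (ZMod n) :=
  ((List.range n).map (fun k : ℕ => (k : ZMod n))).insertionSort (fun a b => u a ≤ u b)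

/-- The first site with property `P` weakly to the left (cyclically) of `i`. -/
def firstLeft (P : ZMod n → Bool) (i : ZMod n) : Option (ZMod n) :=
  ((List.range n).map (fun k : ℕ => i - (k : ZMod n))).find? P

/-- The first site with property `P` weakly to the right (cyclically) of `i`. -/
def firstRight (P : ZMod n → Bool) (i : ZMod n) : Option (ZMod n) :=
  ((List.range n).map (fun k : ℕ => i + (k : ZMod n))).find? P

/-- A word under construction; `none` means that the letter is not set yet. -/
abbrev PartialWord (n : ℕ) : Type := ZMod n → Option ℕ+

/-- Sets the letter at site `j` to `a` (no change when there is no site `j`, which does not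
happen in the algorithm below). -/
def setLetter (v : PartialWord n) (j : Option (ZMod n)) (a : ℕ+) : PartialWord n :=
  match j with
  | none => v
  | some j => Function.update v j (some a)

/-- One step of Phase I: find the first `j` weakly to the left of `i` such that `j ∉ q` and
`v_j` is not set, and set `v_j = u_i + 1`. -/
def stepOne (q : Queue n) (u : Word n) (v : PartialWord n) (i : ZMod n) : PartialWord n :=
  setLetter v (firstLeft (fun j => decide (j ∉ q) && (v j).isNone) i) (u i + 1)

/-- One step of Phase II: find the first `j` weakly to the right of `i` such that `j ∈ q` and
`v_j` is not set, and set `v_j = u_i`. -/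
def stepTwo (q : Queue n) (u : Word n) (v : PartialWord n) (i : ZMod n) : PartialWord n :=
  setLetter v (firstRight (fun j => decide (j ∈ q) && (v j).isNone) i) (u i)

/-- The word `q(u)`. With the sites ordered as `i₁, …, iₙ`, Phase I processes
`iₙ, …, i_{|q|+1}` (in this order), and then Phase II processes `i₁, …, i_{|q|}`.
Phase I sets all letters off `q` and Phase II all letters on `q`, so the default value of
`Option.getD` is never used. -/
def queueAct (q : Queue n) (u : Word n) : Word n :=
  let v₀ : PartialWord n := fun _ => none
  let v₁ := ((siteOrder u).drop q.card).reverse.foldl (stepOne q u) v₀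
  let v₂ := ((siteOrder u).take q.card).foldl (stepTwo q u) v₁
  fun j => (v₂ j).getD 1

/-- The action `q_k(⋯ q₂(q₁(u)) ⋯)` of a sequence of queues on a word. -/
def seqAct {k : ℕ} (q : Fin k → Queue n) (u : Word n) : Word n :=
  (List.ofFn q).foldl (fun w r => queueAct r w) u

variable [NeZero n]

/-- The type of a word: `m_j` is the number of occurrences of `j`. -/
def wordType (u : Word n) : TypeVec := fun j => (Finset.univ.filter (fun s => u s = j)).card

/-- The number of classes of a word: the largest letter. -/
def numClasses (u : Word n) : ℕ+ := Finset.univ.sup u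

/-- A word with `ℓ` classes is packed if each of `1, …, ℓ` occurs in it. -/
def IsPacked (u : Word n) : Prop := ∀ j : ℕ+, j ≤ numClasses u → wordType u j ≠ 0

/-- The (ordinary) multiline queues of a type `m` with `k + 1` classes: the sequences
`(q₁, …, q_k)` of queues such that `q_i` has size `p_i(m)`, where `p_{k+1}(m) = n`.
The indices of `Fin k` start at `0`, so the entry at `i : Fin k` is `q_{i+1}`. -/
def multilineQueues (n : ℕ) [NeZero n] (m : TypeVec) (k : ℕ) : Finset (Fin k → Queue n) :=
  Finset.univ.filter (fun q =>
    (∀ i : Fin k, (q i).card = partialSum m (Nat.succPNat i)) ∧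
      partialSum m (Nat.succPNat k) = n)

/-- The weight `∏_{i ∈ q} x_i` of a queue. -/
noncomputable def queueWeight (q : Queue n) : MvPolynomial (ZMod n) ℤ :=
  ∏ i ∈ q, MvPolynomial.X i

/-- The spectral weight `⟨u⟩` of a word `u` of type `m` with `ℓ` classes: the sum of the weights
of all multiline queues of type `m` (sequences of `ℓ - 1` queues) that map `1ⁿ` to `u`. -/
noncomputable def spectralWeight (u : Word n) : MvPolynomial (ZMod n) ℤ :=
  ∑ q ∈ (multilineQueues n (wordType u) (numClasses u).natPred).filter
      (fun q => seqAct q (fun _ => 1) = u),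
    ∏ i, queueWeight (q i)

theorem finite_setOf_wordType_eq (n : ℕ) [NeZero n] (m : TypeVec) :
    {u : Word n | wordType u = m}.Finite := by
  rcases Set.eq_empty_or_nonempty {u : Word n | wordType u = m} with h | ⟨w, hw⟩
  · rw [h]; exact Set.finite_empty
  · refine (Set.Finite.pi' (fun _ : ZMod n => Set.finite_range w)).subset ?_
    intro u hu s
    have h1 : wordType w (u s) = wordType u (u s) := by
      rw [show wordType w = m from hw, show wordType u = m from hu]
    have h2 : wordType u (u s) ≠ 0 :=
      Finset.card_ne_zero_of_mem (a := s) (by simp)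
    rw [← h1] at h2
    obtain ⟨a, ha⟩ := Finset.card_ne_zero.mp h2
    exact ⟨a, by simpa using ha⟩

/-- The finite set of all words with `n` letters of type `m`. -/
noncomputable def wordsOfType (n : ℕ) [NeZero n] (m : TypeVec) : Finset (Word n) :=
  (finite_setOf_wordType_eq n m).toFinset

end Sites

end MLQ

/-! A word is determined by its level sets, the sets of sites with letter at most `j`. A queue `q`
acts on each of them by a rule that forgets the rest of the word (`level_queueAct`). A level set no
larger than `q` moves as a cloud of indistinguishable particles, which travel right and stop in `q`.
A larger one is moved by its holes, which travel left and stop outside `q`, and its index rises by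
one. Between the two ranges, `q` itself enters as a level set.

The order of the queue sizes is irrelevant. Two consecutive queues `q₁, q₂` can be replaced by
`coact q₁ q₂, act q₁ q₂`, which have the sizes exchanged, the same product of weights and the same
effect on every word (`queueAct_queueAct`). On level sets this is the last component of the
Yang–Baxter equation `yangBaxterAt`, together with the boundary cases in which a queue enters as a
level set. Hence the weighted sums `seqSum` depend only on the multiset of sizes (`seqSum_perm`).

To merge one pair of classes `t, t + 1`, note that the queue sizes for a word of type `m` are those
for `v` and one further size `p_t(m)`. Let a queue of this size act first. On `1ⁿ` it only inserts a
level set, and every later queue preserves the relation "equal up to the omission of a level set of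
`p_t(m)` elements" (`OmitsLevel.queueAct`). At the end, the larger word has type `m` and merges to
`v` exactly when the smaller word is `v`. The first queue is therefore unconstrained and contributes
the factor `e_{p_t(m)}`. A general `T` follows by adjoining its elements in decreasing order. -/

namespace MLQ

/-! ### Flows of particles and holes on the circle, and the exchange of two sets -/

section Transport

variable {n : ℕ}

/-- The indicator function of a set of sites. -/
def chi (A : Finset (ZMod n)) (i : ZMod n) : ℤ := if i ∈ A then 1 else 0

theorem chi_cases (A : Finset (ZMod n)) (i : ZMod n) :
    (i ∈ A ∧ chi A i = 1) ∨ (i ∉ A ∧ chi A i = 0) := by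
  by_cases h : i ∈ A <;> simp [chi, h]

theorem eq_of_chi_eq {A B : Finset (ZMod n)} (h : ∀ i, chi A i = chi B i) : A = B := by
  ext i
  have := h i
  rcases chi_cases A i with ⟨h1, h2⟩ | ⟨h1, h2⟩ <;> rcases chi_cases B i with ⟨h3, h4⟩ | ⟨h3, h4⟩ <;>
    first | (exfalso; omega) | tauto

theorem exists_chi_eq [NeZero n] {f : ZMod n → ℤ} (hf : ∀ i, f i = 0 ∨ f i = 1) :
    ∃ A : Finset (ZMod n), ∀ i, chi A i = f i := by
  classical
  refine ⟨Finset.univ.filter (fun i => f i = 1), fun i => ?_⟩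
  rcases hf i with h | h <;> simp [chi, h]

theorem sum_shift [NeZero n] (W : ZMod n → ℤ) (e : ZMod n) : ∑ i, W (i - e) = ∑ i, W i :=
  Equiv.sum_comp (Equiv.subRight e) W

theorem sum_chi [NeZero n] (A : Finset (ZMod n)) : ∑ i, chi A i = A.card := by
  simp [chi]

theorem card_eq_of_flow [NeZero n] {A D : Finset (ZMod n)} {W : ZMod n → ℤ} (e : ZMod n)
    (h : ∀ i, chi D i = chi A i + W (i - e) - W i) : D.card = A.card := by
  have h1 : ∑ i, chi D i = ∑ i, (chi A i + W (i - e) - W i) := Finset.sum_congr rfl fun i _ => h i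
  rw [Finset.sum_sub_distrib, Finset.sum_add_distrib, sum_shift, sum_chi, sum_chi] at h1
  omega

/-- Particles at the sites of `A` travel to the right and stop at free sites of `q`; the set `D` is
the set of the sites where they stop, and `W i` is their number between `i` and `i + 1`. -/
def FlowRight (A q D : Finset (ZMod n)) (W : ZMod n → ℤ) : Prop := ∀ i,
  W i = max 0 (W (i - 1) + chi A i - chi q i) ∧ chi D i = chi A i + W (i - 1) - W i

/-- Holes, at the sites outside `A`, travel to the left and stop at free sites outside `q`; the set
`D` is the complement of the set of the sites where they stop. -/
def FlowLeft (A q D : Finset (ZMod n)) (W : ZMod n → ℤ) : Prop := ∀ i,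
  W (i - 1) = max 0 (W i + chi q i - chi A i) ∧ chi D i = chi A i + W (i - 1) - W i

/-- The queue `q` sends the set `A` to the set `D`. -/
def Transmits (A q D : Finset (ZMod n)) : Prop := ∃ W, FlowRight A q D W ∨ FlowLeft A q D W

theorem FlowRight.subset {A q D : Finset (ZMod n)} {W : ZMod n → ℤ} (h : FlowRight A q D W) :
    D ⊆ q := by
  intro i hi
  have := h i
  have := h (i - 1)
  rcases chi_cases D i with h1 | h1 <;> rcases chi_cases q i with h2 | h2 <;>
    rcases chi_cases A i with h3 | h3 <;> first | exact h2.1 | exact absurd hi h1.1 | (exfalso; omega)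

theorem FlowLeft.subset {A q D : Finset (ZMod n)} {W : ZMod n → ℤ} (h : FlowLeft A q D W) :
    q ⊆ D := by
  intro i hi
  have := h i
  have := h (i + 1)
  rw [add_sub_cancel_right] at this
  rcases chi_cases D i with h1 | h1 <;> rcases chi_cases q i with h2 | h2 <;>
    rcases chi_cases A i with h3 | h3 <;> first | exact h1.1 | exact absurd hi h2.1 | (exfalso; omega)

/-- The nonnegative differences `g (i - 1) - g i` sum to zero around the circle, so each of them
vanishes. -/
theorem eq_shift_of_le_shift [NeZero n] {g : ZMod n → ℤ} (h : ∀ i, g i ≤ g (i - 1)) (i : ZMod n) :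
    g i = g (i - 1) := by
  have h1 : ∑ i, (g (i - 1) - g i) = 0 := by rw [Finset.sum_sub_distrib, sum_shift, sub_self]
  have := (Finset.sum_eq_zero_iff_of_nonneg (fun i _ => sub_nonneg.2 (h i))).1 h1 i (Finset.mem_univ i)
  omega

theorem eq_shift_of_shift_le [NeZero n] {g : ZMod n → ℤ} (h : ∀ i, g (i - 1) ≤ g i) (i : ZMod n) :
    g i = g (i - 1) := by
  have := eq_shift_of_le_shift (g := fun i => - g i) (fun i => neg_le_neg (h i)) i
  simpa using this

/-- The current `W` need not be unique: if `A` and `q` have equal size, a constant can be added to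
it. But one step of the recursion is monotone and 1-Lipschitz, so `|W - W'|` cannot grow along the
circle and is constant; then `W - W'` is constant too, and `D` depends only on differences of `W`.
-/
theorem FlowRight.unique [NeZero n] {A q D D' : Finset (ZMod n)} {W W' : ZMod n → ℤ}
    (h : FlowRight A q D W) (h' : FlowRight A q D' W') : D = D' := by
  have key := eq_shift_of_le_shift (g := fun i => max (W i - W' i) (W' i - W i)) (fun i => by
    have := (h i).1
    have := (h' i).1
    omega)
  refine eq_of_chi_eq fun i => ?_
  have := h i
  have := h' i
  have := key i
  omega

theorem FlowLeft.unique [NeZero n] {A q D D' : Finset (ZMod n)} {W W' : ZMod n → ℤ}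
    (h : FlowLeft A q D W) (h' : FlowLeft A q D' W') : D = D' := by
  have key := eq_shift_of_shift_le (g := fun i => max (W i - W' i) (W' i - W i)) (fun i => by
    have := (h i).1
    have := (h' i).1
    omega)
  refine eq_of_chi_eq fun i => ?_
  have := h i
  have := h' i
  have := key i
  omega

variable [NeZero n]

theorem FlowRight.card_eq {A q D : Finset (ZMod n)} {W : ZMod n → ℤ} (h : FlowRight A q D W) :
    D.card = A.card := card_eq_of_flow 1 fun i => (h i).2

theorem FlowLeft.card_eq {A q D : Finset (ZMod n)} {W : ZMod n → ℤ} (h : FlowLeft A q D W) :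
    D.card = A.card := card_eq_of_flow 1 fun i => (h i).2

theorem Transmits.card_eq {A q D : Finset (ZMod n)} (h : Transmits A q D) : D.card = A.card := by
  obtain ⟨W, h | h⟩ := h
  · exact h.card_eq
  · exact h.card_eq

/-- When `A` is not larger than `q`, a left flow must have `D = q` by counting, and the same `W`
then also solves the recursion to the right. So the sizes alone decide which kind of flow may be
used. -/
theorem Transmits.flowRight {A q D : Finset (ZMod n)} (h : Transmits A q D)
    (hc : A.card ≤ q.card) : ∃ W, FlowRight A q D W := by
  obtain ⟨W, h | h⟩ := h
  · exact ⟨W, h⟩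
  · have hD : q = D := Finset.eq_of_subset_of_card_le h.subset (h.card_eq.trans_le hc)
    subst hD
    refine ⟨W, fun i => ?_⟩
    have := h i
    have := h (i + 1)
    rw [add_sub_cancel_right] at this
    omega

theorem Transmits.flowLeft {A q D : Finset (ZMod n)} (h : Transmits A q D)
    (hc : q.card ≤ A.card) : ∃ W, FlowLeft A q D W := by
  obtain ⟨W, h | h⟩ := h
  · have hD : D = q := Finset.eq_of_subset_of_card_le h.subset (hc.trans_eq h.card_eq.symm)
    subst hD
    refine ⟨W, fun i => ?_⟩
    have := h i
    have := h (i - 1)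
    omega
  · exact ⟨W, h⟩

theorem Transmits.unique {A q D D' : Finset (ZMod n)} (h : Transmits A q D)
    (h' : Transmits A q D') : D = D' := by
  rcases le_total A.card q.card with hc | hc
  · obtain ⟨W, h⟩ := h.flowRight hc
    obtain ⟨W', h'⟩ := h'.flowRight hc
    exact h.unique h'
  · obtain ⟨W, h⟩ := h.flowLeft hc
    obtain ⟨W', h'⟩ := h'.flowLeft hc
    exact h.unique h'

theorem Transmits.eq_of_card_eq {A q D : Finset (ZMod n)} (h : Transmits A q D)
    (hc : A.card = q.card) : D = q := by
  obtain ⟨W, h⟩ := h.flowRight hc.le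
  exact Finset.eq_of_subset_of_card_le h.subset (by rw [h.card_eq, hc])

/-- The pair of sets `(A, q)` is exchanged to the pair `(q', D)`: the set `A` passes through `q`
and becomes `D`. -/
def Exchanges (A q q' D : Finset (ZMod n)) : Prop :=
  Transmits A q D ∧ ∀ i, chi q' i + chi D i = chi A i + chi q i

theorem Transmits.exists_exchanges {A q D : Finset (ZMod n)} (h : Transmits A q D) :
    ∃ q', Exchanges A q q' D := by
  obtain ⟨q', hq'⟩ := exists_chi_eq (f := fun i => chi A i + chi q i - chi D i) (fun i => by
    obtain ⟨W, h⟩ := h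
    have h0 : 0 ≤ W i ∧ 0 ≤ W (i - 1) := by
      rcases h with h | h
      · have := h i; have := h (i - 1); omega
      · have := h i; have := h (i + 1)
        rw [add_sub_cancel_right] at this
        omega
    have : (W i = max 0 (W (i - 1) + chi A i - chi q i) ∨
      W (i - 1) = max 0 (W i + chi q i - chi A i)) ∧ chi D i = chi A i + W (i - 1) - W i := by
      rcases h with h | h
      · exact ⟨Or.inl (h i).1, (h i).2⟩
      · exact ⟨Or.inr (h i).1, (h i).2⟩
    have := chi_cases A i
    have := chi_cases q i
    have := chi_cases D i
    omega)
  exact ⟨q', h, fun i => by rw [hq']; ring⟩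

theorem Exchanges.unique {A q q' D q'' D' : Finset (ZMod n)} (h : Exchanges A q q' D)
    (h' : Exchanges A q q'' D') : q' = q'' ∧ D = D' := by
  have hD := h.1.unique h'.1
  subst hD
  refine ⟨eq_of_chi_eq fun i => ?_, rfl⟩
  have := h.2 i
  have := h'.2 i
  omega

-- Reversal of motion: the same current `W` serves, with right and left flows interchanged. This
-- makes the exchange an involution.
omit [NeZero n] in
theorem Exchanges.symm {A q q' D : Finset (ZMod n)} (h : Exchanges A q q' D) :
    Exchanges q' D A q := by
  obtain ⟨⟨W, hW⟩, h2⟩ := h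
  refine ⟨⟨W, ?_⟩, fun i => (h2 i).symm⟩
  rcases hW with h | h
  · right
    intro i
    have := h i; have := h (i - 1); have := h2 i
    have := chi_cases A i
    have := chi_cases q i
    have := chi_cases D i
    omega
  · left
    intro i
    have := h i; have := h (i + 1); have := h2 i
    simp only [add_sub_cancel_right] at *
    have := chi_cases A i
    have := chi_cases q i
    have := chi_cases D i
    omega

theorem Exchanges.card_eq {A q q' D : Finset (ZMod n)} (h : Exchanges A q q' D) :
    D.card = A.card ∧ q'.card = q.card :=
  ⟨h.1.card_eq, h.symm.1.card_eq.symm⟩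

theorem chi_compl (A : Finset (ZMod n)) (i : ZMod n) : chi Aᶜ i = 1 - chi A i := by
  by_cases h : i ∈ A <;> simp [chi, h]

/-- Particle–hole duality: passing to complements swaps the roles of the two sets and keeps the
current and its direction. -/
theorem Exchanges.compl {A q q' D : Finset (ZMod n)} (h : Exchanges A q q' D) :
    Exchanges qᶜ Aᶜ Dᶜ q'ᶜ := by
  obtain ⟨⟨W, hW⟩, h2⟩ := h
  refine ⟨⟨W, ?_⟩, fun i => ?_⟩
  · rcases hW with h | h
    · left
      intro i
      have := h i; have := h2 i
      simp only [chi_compl]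
      omega
    · right
      intro i
      have := h i; have := h2 i
      simp only [chi_compl]
      omega
  · have := h2 i
    simp only [chi_compl]
    omega

/-- One site of the comparison of currents: unprimed `w`'s enter the site and primed ones leave it,
and `a, b, c` are the indicators of `A, q₁, q₂` there. Here `w` is the current of `q₁` through `q₂`,
and `w₁, w₂` are the currents of `A` through the exchanged queues. The total `w₁ + w₂` is
redistributed: `min w w₂` passes through `q₂` and the rest through `q₁`. -/
theorem queue_recursion {w w₁ w₂ w' w₁' w₂' a b c b' c' d e : ℤ} (hw : 0 ≤ w) (hw₁ : 0 ≤ w₁)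
    (hw₂ : 0 ≤ w₂) (ha : a = 0 ∨ a = 1) (hb : b = 0 ∨ b = 1) (hc : c = 0 ∨ c = 1)
    (h : w' = max 0 (w + b - c)) (hc' : c' = b + w - w') (hb' : b' + c' = b + c)
    (h₁ : w₁' = max 0 (w₁ + a - b')) (hd : d = a + w₁ - w₁')
    (h₂ : w₂' = max 0 (w₂ + d - c')) (he : e = d + w₂ - w₂') :
    w₁' + w₂' - min w' w₂' = max 0 (w₁ + w₂ - min w w₂ + a - b) ∧
    min w' w₂' = max 0 (min w w₂ + (a + (w₁ + w₂ - min w w₂) - (w₁' + w₂' - min w' w₂')) - c) ∧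
    e = a + (w₁ + w₂ - min w w₂) - (w₁' + w₂' - min w' w₂') + min w w₂ - min w' w₂' := by
  have hb'' : b' = c + w' - w := by omega
  clear hb'
  subst he hd hb'' hc'
  refine ⟨?_, ?_, by ring⟩ <;> rcases ha with rfl | rfl <;> rcases hb with rfl | rfl <;>
    rcases hc with rfl | rfl <;> omega

/-- Interchangeability of two queues, for a set that is smaller than both. -/
theorem exists_flow_of_flow {A q₁ q₂ q₁' q₂' D E : Finset (ZMod n)} {W W₁ W₂ : ZMod n → ℤ}
    (h : FlowRight q₁ q₂ q₂' W) (hq : ∀ i, chi q₁' i + chi q₂' i = chi q₁ i + chi q₂ i)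
    (h₁ : FlowRight A q₁' D W₁) (h₂ : FlowRight D q₂' E W₂) :
    ∃ X V₁ V₂, FlowRight A q₁ X V₁ ∧ FlowRight X q₂ E V₂ := by
  have h01 (B : Finset (ZMod n)) (i) : chi B i = 0 ∨ chi B i = 1 := by
    rcases chi_cases B i with h | h <;> simp [h]
  have key (i) := queue_recursion (w := W (i - 1)) (w₁ := W₁ (i - 1)) (w₂ := W₂ (i - 1))
    (by rw [(h _).1]; exact le_max_left _ _) (by rw [(h₁ _).1]; exact le_max_left _ _)
    (by rw [(h₂ _).1]; exact le_max_left _ _) (h01 A i) (h01 q₁ i) (h01 q₂ i) (h i).1 (h i).2 (hq i)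
    (h₁ i).1 (h₁ i).2 (h₂ i).1 (h₂ i).2
  obtain ⟨V, hV⟩ : ∃ V : ZMod n → ℤ, ∀ i, V i = W₁ i + W₂ i - min (W i) (W₂ i) :=
    ⟨_, fun _ => rfl⟩
  simp only [← hV] at key
  obtain ⟨X, hX⟩ := exists_chi_eq (f := fun i => chi A i + V (i - 1) - V i) (fun i => by
    have := (key i).1
    have := (key (i - 1)).1
    have := h01 A i
    have := h01 q₁ i
    omega)
  refine ⟨X, V, fun i => min (W i) (W₂ i), fun i => ⟨(key i).1, hX i⟩, fun i => ?_⟩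
  have := hX i
  exact ⟨by rw [this]; exact (key i).2.1, by rw [this]; exact (key i).2.2⟩

theorem transmits_interchange_of_card_le {A q₁ q₂ q₁' q₂' D E D' E' : Finset (ZMod n)}
    (hq : Exchanges q₁ q₂ q₁' q₂') (h₁ : Transmits A q₁ D) (h₂ : Transmits D q₂ E)
    (h₁' : Transmits A q₁' D') (h₂' : Transmits D' q₂' E')
    (h12 : q₁.card ≤ q₂.card) (hA : A.card ≤ q₁.card) : E = E' := by
  have e1 := hq.card_eq
  have e2 := h₁.card_eq
  have e3 := h₁'.card_eq
  obtain ⟨W, hW⟩ := hq.1.flowRight h12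
  obtain ⟨W₁, hW₁⟩ := h₁'.flowRight (by omega)
  obtain ⟨W₂, hW₂⟩ := h₂'.flowRight (by omega)
  obtain ⟨X, V₁, V₂, hV₁, hV₂⟩ := exists_flow_of_flow hW hq.2 hW₁ hW₂
  have hX : X = D := Transmits.unique ⟨V₁, Or.inl hV₁⟩ h₁
  subst hX
  exact h₂.unique ⟨V₂, Or.inl hV₂⟩

end Transport

end MLQ

namespace MLQ

/-! ### Both phases as one parking process, with step `e = 1` or `e = -1` -/

section Parking

variable {n : ℕ} [NeZero n]

/-- The letter `a` is set at the first site of `q` without a letter among `i, i + e, i + 2e, …`. -/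
def park (e : ZMod n) (q : Queue n) (f : ZMod n → ℕ+) (v : PartialWord n) (i : ZMod n) :
    PartialWord n :=
  setLetter v (((List.range n).map (fun k : ℕ => i + e * (k : ZMod n))).find?
    (fun j => decide (j ∈ q) && (v j).isNone)) (f i)

omit [NeZero n] in
theorem stepTwo_eq_park (q : Queue n) (u : Word n) : stepTwo q u = park 1 q u := by
  funext v i
  simp [stepTwo, park, firstRight]

theorem stepOne_eq_park (q : Queue n) (u : Word n) :
    stepOne q u = park (-1) qᶜ (fun i => u i + 1) := by
  funext v i
  simp [stepOne, park, firstLeft, sub_eq_add_neg]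

/-- The sites of `q` that have a letter. -/
def occupied (q : Queue n) (v : PartialWord n) : Finset (ZMod n) := q.filter (fun s => v s ≠ none)

/-- The particles started at the sites of `A` have moved with steps `e` to the occupied sites of
`q`, without passing a free site. -/
def ParkedFrom (e : ZMod n) (q : Queue n) (A : Finset (ZMod n)) (v : PartialWord n) : Prop :=
  ∃ W : ZMod n → ℤ, (∀ i, 0 ≤ W i) ∧
    (∀ i, chi (occupied q v) i = chi A i + W (i - e) - W i) ∧ ∀ i ∈ q, v i = none → W i = 0

theorem ParkedFrom.card_eq {e : ZMod n} {q : Queue n} {A : Finset (ZMod n)} {v : PartialWord n}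
    (h : ParkedFrom e q A v) : (occupied q v).card = A.card := by
  obtain ⟨W, -, h, -⟩ := h
  exact card_eq_of_flow e h

omit [NeZero n] in
theorem exists_first_free {P : ZMod n → Bool} {i e : ZMod n}
    (h : ∃ k < n, P (i + e * (k : ZMod n)) = true) :
    ∃ k < n, P (i + e * (k : ZMod n)) = true ∧ (∀ k' < k, P (i + e * (k' : ZMod n)) = false) ∧
      ((List.range n).map (fun k : ℕ => i + e * (k : ZMod n))).find? P =
        some (i + e * (k : ZMod n)) := by
  classical
  obtain ⟨h1, h2⟩ := Nat.find_spec h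
  refine ⟨Nat.find h, h1, h2, fun k' hk' => ?_, ?_⟩
  · have := Nat.find_min h hk'
    simpa [hk'.trans h1] using this
  · rw [List.find?_map, Option.map_eq_some_iff]
    refine ⟨Nat.find h, ?_, rfl⟩
    rw [List.find?_range_eq_some]
    refine ⟨h2, by simpa using h1, fun j hj => ?_⟩
    have := Nat.find_min h hj
    simpa [hj.trans h1] using this

theorem exists_mul_natCast {e : ZMod n} (he : e * e = 1) (i s : ZMod n) :
    ∃ k < n, i + e * (k : ZMod n) = s := by
  refine ⟨(e * (s - i)).val, ZMod.val_lt _, ?_⟩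
  rw [ZMod.natCast_zmod_val, ← mul_assoc, he, one_mul, add_sub_cancel]

theorem ParkedFrom.park {e : ZMod n} (he : e * e = 1) {q : Queue n} {f : ZMod n → ℕ+}
    {A : Finset (ZMod n)} {v : PartialWord n} (h : ParkedFrom e q A v) {i : ZMod n} (hi : i ∉ A)
    (hc : A.card < q.card) : ParkedFrom e q (insert i A) (park e q f v i) ∧
      ∃ s ∈ q, v s = none ∧ MLQ.park e q f v i = Function.update v s (some (f i)) := by
  have hfree : ∃ s ∈ q, v s = none := by
    by_contra! hs
    have : occupied q v = q := Finset.filter_true_of_mem hs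
    rw [← h.card_eq, this] at hc
    exact lt_irrefl _ hc
  obtain ⟨s, hs, hvs⟩ := hfree
  obtain ⟨k₀, hk₀, rfl⟩ := exists_mul_natCast he i s
  obtain ⟨k, hk, hP, hmin, hfind⟩ := exists_first_free
    (P := fun j => decide (j ∈ q) && (v j).isNone) (i := i) (e := e) ⟨k₀, hk₀, by simp [hs, hvs]⟩
  have hpark : MLQ.park e q f v i = Function.update v (i + e * (k : ZMod n)) (some (f i)) := by
    rw [MLQ.park, hfind]; rfl
  simp only [Bool.and_eq_true, decide_eq_true_eq, Option.isNone_iff_eq_none] at hP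
  refine ⟨?_, _, hP.1, hP.2, hpark⟩
  rw [hpark]
  obtain ⟨W, hW0, hW, hWq⟩ := h
  have hocc : occupied q (Function.update v (i + e * (k : ZMod n)) (some (f i))) =
      insert (i + e * (k : ZMod n)) (occupied q v) := by
    ext t
    by_cases ht : t = i + e * (k : ZMod n)
    · subst ht; simp [occupied, hP.1]
    · simp [occupied, ht]
  have hchi (B : Finset (ZMod n)) (a t : ZMod n) (ha : a ∉ B) :
      chi (insert a B) t = chi B t + if a = t then 1 else 0 := by
    by_cases hat : a = t
    · subst hat; simp [chi, ha]
    · simp [chi, hat, Ne.symm hat]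
  -- The new particle adds one to the current at every site that it leaves; the change of divergence
  -- telescopes to its two endpoints. It passes no free site, since `k` is the first index of one.
  refine ⟨fun t => W t + ∑ k' ∈ Finset.range k, if i + e * (k' : ZMod n) = t then 1 else 0,
    fun t => add_nonneg (hW0 t) (Finset.sum_nonneg fun k' _ => by split_ifs <;> norm_num),
    fun t => ?_, fun t ht hvt => ?_⟩
  · rw [hocc, hchi _ _ _ (by simp [occupied, hP.2]), hchi _ _ _ hi, hW]
    have h1 : ∑ k' ∈ Finset.range k, (if i + e * (k' : ZMod n) = t - e then (1 : ℤ) else 0) -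
        ∑ k' ∈ Finset.range k, (if i + e * (k' : ZMod n) = t then (1 : ℤ) else 0) =
        (if i + e * (k : ZMod n) = t then 1 else 0) - if i = t then 1 else 0 := by
      have h2 := Finset.sum_range_sub
        (fun k' : ℕ => if i + e * (k' : ZMod n) = t then (1 : ℤ) else 0) k
      simp only [Nat.cast_zero, mul_zero, add_zero] at h2
      rw [← h2, ← Finset.sum_sub_distrib]
      refine Finset.sum_congr rfl fun k' _ => ?_
      congr 2
      rw [eq_sub_iff_add_eq, Nat.cast_succ, mul_add, mul_one, add_assoc]
    linarith
  · have htk : t ≠ i + e * (k : ZMod n) := by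
      rintro rfl
      simp at hvt
    rw [Function.update_of_ne htk] at hvt
    change W t + _ = 0
    rw [hWq t ht hvt, zero_add]
    refine Finset.sum_eq_zero fun k' hk' => if_neg ?_
    rintro rfl
    have := hmin k' (Finset.mem_range.1 hk')
    simp [ht, hvt] at this

theorem ParkedFrom.foldl {e : ZMod n} (he : e * e = 1) {q : Queue n} {f : ZMod n → ℕ+}
    (L : List (ZMod n)) : ∀ {A : Finset (ZMod n)} {v : PartialWord n}, ParkedFrom e q A v →
    L.Nodup → (∀ i ∈ L, i ∉ A) → A.card + L.length ≤ q.card →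
    ParkedFrom e q (A ∪ L.toFinset) (L.foldl (MLQ.park e q f) v) ∧
      ∀ s, L.foldl (MLQ.park e q f) v s = v s ∨
        (v s = none ∧ s ∈ q ∧ ∃ i ∈ L, L.foldl (MLQ.park e q f) v s = some (f i)) := by
  induction L with
  | nil => intro A v h _ _ _; simpa using h
  | cons i L ih =>
    intro A v h hL hA hc
    rw [List.nodup_cons] at hL
    have hi : i ∉ A := hA i (by simp)
    rw [List.length_cons] at hc
    obtain ⟨h1, s, hs, hvs, hpark⟩ := h.park he (f := f) hi (by omega)
    obtain ⟨h2, h3⟩ := ih h1 hL.2 (fun j hj => by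
      simp only [Finset.mem_insert, not_or]
      exact ⟨fun hji => hL.1 (hji ▸ hj), hA j (by simp [hj])⟩) (by
      rw [Finset.card_insert_of_notMem hi]; omega)
    rw [List.foldl_cons]
    refine ⟨by convert h2 using 1; ext; simp, fun t => ?_⟩
    rcases h3 t with h4 | ⟨h4, h5, j, hj, h6⟩
    · rw [h4, hpark]
      by_cases hts : t = s
      · subst hts
        right
        exact ⟨hvs, hs, i, by simp, by simp⟩
      · left; simp [hts]
    · rw [hpark] at h4
      by_cases hts : t = s
      · subst hts; simp at h4
      · right
        rw [Function.update_of_ne hts] at h4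
        exact ⟨h4, h5, j, by simp [hj], h6⟩

omit [NeZero n] in
theorem parkedFrom_empty (e : ZMod n) (q : Queue n) {v : PartialWord n}
    (hv : ∀ s ∈ q, v s = none) : ParkedFrom e q ∅ v := by
  refine ⟨0, by simp, fun i => ?_, by simp⟩
  have : occupied q v = ∅ := Finset.filter_false_of_mem (by simpa using hv)
  simp [this, chi]

end Parking

/-! ### Level sets and the sorted list of sites -/

section Levels

variable {n : ℕ} [NeZero n]

/-- The sites with a letter at most `j`. -/
def level (u : Word n) (j : ℕ) : Finset (ZMod n) := Finset.univ.filter (fun s => (u s : ℕ) ≤ j)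

theorem mem_level {u : Word n} {j : ℕ} {s : ZMod n} : s ∈ level u j ↔ (u s : ℕ) ≤ j := by
  simp [level]

omit [NeZero n] in
theorem perm_siteOrder (u : Word n) :
    (siteOrder u).Perm ((List.range n).map (fun k : ℕ => (k : ZMod n))) :=
  List.perm_insertionSort _ _

omit [NeZero n] in
theorem nodup_siteOrder (u : Word n) : (siteOrder u).Nodup := by
  rw [(perm_siteOrder u).nodup_iff]
  refine List.Nodup.map_on (fun a ha b hb hab => ?_) List.nodup_range
  rw [List.mem_range] at ha hb
  have := congrArg ZMod.val hab
  rwa [ZMod.val_natCast_of_lt ha, ZMod.val_natCast_of_lt hb] at this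

theorem mem_siteOrder (u : Word n) (s : ZMod n) : s ∈ siteOrder u := by
  rw [(perm_siteOrder u).mem_iff, List.mem_map]
  exact ⟨s.val, List.mem_range.2 (ZMod.val_lt s), ZMod.natCast_zmod_val s⟩

omit [NeZero n] in
theorem length_siteOrder (u : Word n) : (siteOrder u).length = n := by
  simp [(perm_siteOrder u).length_eq]

theorem filter_append_filter_not {α : Type*} {r : α → α → Prop} {p : α → Bool}
    (hp : ∀ a b, r a b → p b = true → p a = true) {l : List α} (hl : l.Pairwise r) :
    l.filter p ++ l.filter (fun a => !p a) = l := by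
  induction l with
  | nil => rfl
  | cons a l ih =>
    rw [List.pairwise_cons] at hl
    by_cases ha : p a = true
    · simp [ha, ih hl.2]
    · have : ∀ b ∈ l, p b = false := fun b hb => by
        by_contra hpb
        exact ha (hp a b (hl.1 b hb) (by simpa using hpb))
      simp only [ha, List.filter_cons]
      have h1 : l.filter p = [] := List.filter_eq_nil_iff.2 fun b hb => by simp [this b hb]
      have h2 : l.filter (fun b => !p b) = l := List.filter_eq_self.2 fun b hb => by simp [this b hb]
      simp [h1, h2]

theorem exists_siteOrder_eq_append (u : Word n) (j : ℕ) : ∃ L L', siteOrder u = L ++ L' ∧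
    L.toFinset = level u j ∧ L'.toFinset = (level u j)ᶜ ∧ L.length = (level u j).card ∧
    L.Nodup ∧ L'.Nodup := by
  have hs : (siteOrder u).Pairwise (fun a b => u a ≤ u b) := by
    have : Std.Total (fun a b : ZMod n => u a ≤ u b) := ⟨fun a b => le_total _ _⟩
    have : IsTrans (ZMod n) (fun a b : ZMod n => u a ≤ u b) := ⟨fun a b c => le_trans⟩
    exact List.pairwise_insertionSort _ _
  have h := filter_append_filter_not (p := fun a => decide ((u a : ℕ) ≤ j)) (fun a b hab hb => by
    simp only [decide_eq_true_eq] at hb ⊢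
    exact le_trans (by exact_mod_cast hab) hb) hs
  have hL : ((siteOrder u).filter (fun a => decide ((u a : ℕ) ≤ j))).toFinset = level u j := by
    ext s; simp [mem_siteOrder, mem_level]
  refine ⟨_, _, h.symm, hL, ?_, ?_, (nodup_siteOrder u).filter _, (nodup_siteOrder u).filter _⟩
  · ext s; simp [mem_siteOrder, mem_level]
  · rw [← hL, List.toFinset_card_of_nodup ((nodup_siteOrder u).filter _)]

theorem mem_take_siteOrder {u : Word n} {j c : ℕ} (hc : c ≤ (level u j).card) {s : ZMod n}
    (hs : s ∈ (siteOrder u).take c) : (u s : ℕ) ≤ j := by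
  obtain ⟨L, L', h, hL, -, hlen, -, -⟩ := exists_siteOrder_eq_append u j
  rw [h, List.take_append_of_le_length (hlen ▸ hc)] at hs
  have := List.mem_of_mem_take hs
  rwa [← List.mem_toFinset, hL, mem_level] at this

theorem mem_drop_siteOrder {u : Word n} {j c : ℕ} (hc : (level u j).card ≤ c) {s : ZMod n}
    (hs : s ∈ (siteOrder u).drop c) : j < (u s : ℕ) := by
  obtain ⟨L, L', h, -, hL', hlen, -, -⟩ := exists_siteOrder_eq_append u j
  rw [h, List.drop_append, List.drop_of_length_le (hlen ▸ hc), List.nil_append] at hs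
  have := List.mem_of_mem_drop hs
  rw [← List.mem_toFinset, hL', Finset.mem_compl, mem_level] at this
  omega

end Levels

end MLQ

namespace MLQ

/-! ### The action of a queue on level sets -/

section QueueAction

variable {n : ℕ} [NeZero n]

/-- Later particles never overwrite a letter, so the sites occupied after the prefix `La` are
exactly those whose final letter comes from `La`. This reduces a statement on letters to one on
sets. -/
theorem exists_parked_prefix {e : ZMod n} (he : e * e = 1) {q : Queue n} {f : ZMod n → ℕ+}
    {v : PartialWord n} (hv : ∀ s ∈ q, v s = none) {La Lb : List (ZMod n)}
    (hL : (La ++ Lb).Nodup) (hc : (La ++ Lb).length = q.card) :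
    ∃ D ⊆ q, (∃ W : ZMod n → ℤ, (∀ i, 0 ≤ W i) ∧
        (∀ i, chi D i = chi La.toFinset i + W (i - e) - W i) ∧ ∀ i ∈ q, i ∉ D → W i = 0) ∧
      (∀ s ∈ D, ∃ i ∈ La, (La ++ Lb).foldl (park e q f) v s = some (f i)) ∧
      (∀ s ∈ q, s ∉ D → ∃ i ∈ Lb, (La ++ Lb).foldl (park e q f) v s = some (f i)) ∧
      ∀ s ∉ q, (La ++ Lb).foldl (park e q f) v s = v s := by
  rw [List.length_append] at hc
  obtain ⟨hNa, hNb, hd⟩ := List.nodup_append.1 hL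
  have h0 := parkedFrom_empty e q hv
  obtain ⟨h1, h2⟩ := h0.foldl he (f := f) La hNa (by simp) (by simp; omega)
  rw [Finset.empty_union] at h1
  obtain ⟨h3, h4⟩ := h1.foldl he (f := f) Lb hNb
    (fun i hi hi' => hd _ (List.mem_toFinset.1 hi') _ hi rfl)
    (by rw [List.toFinset_card_of_nodup hNa]; omega)
  rw [← List.toFinset_append, ← List.foldl_append] at h3
  rw [← List.foldl_append] at h4
  have hocc : occupied q ((La ++ Lb).foldl (park e q f) v) = q := by
    refine Finset.eq_of_subset_of_card_le (Finset.filter_subset _ _) ?_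
    rw [h3.card_eq, List.toFinset_card_of_nodup hL, List.length_append, hc]
  refine ⟨occupied q (La.foldl (park e q f) v), Finset.filter_subset _ _, ?_, ?_, ?_, ?_⟩
  · obtain ⟨W, hW0, hW, hWq⟩ := h1
    refine ⟨W, hW0, hW, fun i hi hiD => hWq i hi ?_⟩
    by_contra hne
    exact hiD (Finset.mem_filter.2 ⟨hi, hne⟩)
  · intro s hs
    obtain ⟨hsq, hne⟩ := Finset.mem_filter.1 hs
    rcases h4 s with h5 | h5
    · rcases h2 s with h6 | ⟨-, -, i, hi, h6⟩
      · exact absurd (h6.trans (hv s hsq)) hne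
      · exact ⟨i, hi, h5.trans h6⟩
    · exact absurd h5.1 hne
  · intro s hs hsD
    have hnone : La.foldl (park e q f) v s = none := by
      by_contra hne
      exact hsD (Finset.mem_filter.2 ⟨hs, hne⟩)
    rcases h4 s with h5 | ⟨-, -, h5⟩
    · rw [← hocc] at hs
      exact absurd (h5.trans hnone) (Finset.mem_filter.1 hs).2
    · exact h5
  · intro s hs
    rcases h4 s with h5 | h5
    · rcases h2 s with h6 | h6
      · exact h5.trans h6
      · exact absurd h6.2.1 hs
    · exact absurd h5.2.1 hs

theorem length_drop_siteOrder (q : Queue n) (u : Word n) :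
    ((siteOrder u).drop q.card).length = qᶜ.card := by
  rw [List.length_drop, length_siteOrder, Finset.card_compl, ZMod.card]

theorem length_take_siteOrder (q : Queue n) (u : Word n) :
    ((siteOrder u).take q.card).length = q.card := by
  rw [List.length_take, length_siteOrder, min_eq_left]
  exact (Finset.card_le_univ q).trans_eq (ZMod.card n)

theorem exists_phaseOne_prefix (q : Queue n) (u : Word n) {La Lb : List (ZMod n)}
    (h : ((siteOrder u).drop q.card).reverse = La ++ Lb) :
    ∃ D ⊆ qᶜ, (∃ W : ZMod n → ℤ, (∀ i, 0 ≤ W i) ∧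
        (∀ i, chi D i = chi La.toFinset i + W (i + 1) - W i) ∧ ∀ i ∉ q, i ∉ D → W i = 0) ∧
      (∀ s ∈ D, ∃ i ∈ La,
        (La ++ Lb).foldl (stepOne q u) (fun _ => none) s = some (u i + 1)) ∧
      (∀ s ∉ q, s ∉ D → ∃ i ∈ Lb,
        (La ++ Lb).foldl (stepOne q u) (fun _ => none) s = some (u i + 1)) ∧
      ∀ s ∈ q, (La ++ Lb).foldl (stepOne q u) (fun _ => none) s = none := by
  obtain ⟨D, hD, hW, h1, h2, h3⟩ := exists_parked_prefix (e := -1) (by ring) (q := qᶜ)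
    (f := fun i => u i + 1) (v := fun _ => none) (fun _ _ => rfl) (La := La) (Lb := Lb)
    (by rw [← h, List.nodup_reverse]; exact (nodup_siteOrder u).sublist (List.drop_sublist _ _))
    (by rw [← h, List.length_reverse, length_drop_siteOrder])
  rw [← stepOne_eq_park] at h1 h2 h3
  simp only [sub_neg_eq_add, Finset.mem_compl, not_not] at hW h2 h3
  exact ⟨D, hD, hW, h1, h2, h3⟩

theorem exists_phaseTwo_prefix (q : Queue n) (u : Word n) {La Lb : List (ZMod n)}
    (h : (siteOrder u).take q.card = La ++ Lb) :
    ∃ D ⊆ q, (∃ W : ZMod n → ℤ, (∀ i, 0 ≤ W i) ∧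
        (∀ i, chi D i = chi La.toFinset i + W (i - 1) - W i) ∧ ∀ i ∈ q, i ∉ D → W i = 0) ∧
      (∀ s ∈ D, ∃ i ∈ La, queueAct q u s = u i) ∧
      (∀ s ∈ q, s ∉ D → ∃ i ∈ Lb, queueAct q u s = u i) ∧
      ∀ s ∉ q, queueAct q u s = (((siteOrder u).drop q.card).reverse.foldl (stepOne q u)
        (fun _ => none) s).getD 1 := by
  obtain ⟨_, -, -, -, -, h0⟩ := exists_phaseOne_prefix q u (List.append_nil _).symm
  rw [List.append_nil] at h0
  obtain ⟨D, hD, hW, h1, h2, h3⟩ := exists_parked_prefix (e := 1) (by ring) (q := q)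
    (f := u) h0 (La := La) (Lb := Lb)
    (by rw [← h]; exact (nodup_siteOrder u).sublist (List.take_sublist _ _))
    (by rw [← h, length_take_siteOrder])
  rw [← stepTwo_eq_park, ← h] at h1 h2 h3
  refine ⟨D, hD, hW, fun s hs => ?_, fun s hs hsD => ?_, fun s hs => ?_⟩
  · obtain ⟨i, hi, h⟩ := h1 s hs
    exact ⟨i, hi, by rw [queueAct]; simp only [h, Option.getD_some]⟩
  · obtain ⟨i, hi, h⟩ := h2 s hs hsD
    exact ⟨i, hi, by rw [queueAct]; simp only [h, Option.getD_some]⟩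
  · rw [← h3 s hs]; rfl

theorem queueAct_of_mem (q : Queue n) (u : Word n) {s : ZMod n} (hs : s ∈ q) :
    ∃ i ∈ (siteOrder u).take q.card, queueAct q u s = u i := by
  obtain ⟨D, hD, -, h1, h2, -⟩ := exists_phaseTwo_prefix q u (List.append_nil _).symm
  by_cases hsD : s ∈ D
  · exact h1 s hsD
  · obtain ⟨i, hi, -⟩ := h2 s hs hsD
    simp at hi

theorem queueAct_of_notMem (q : Queue n) (u : Word n) {s : ZMod n} (hs : s ∉ q) :
    ∃ i ∈ (siteOrder u).drop q.card, queueAct q u s = u i + 1 := by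
  obtain ⟨_, -, -, -, -, h3⟩ := exists_phaseTwo_prefix q u (List.append_nil _).symm
  obtain ⟨D, hD, -, h1, h2, -⟩ := exists_phaseOne_prefix q u (List.append_nil _).symm
  rw [List.append_nil] at h1
  rw [h3 s hs]
  by_cases hsD : s ∈ D
  · obtain ⟨i, hi, h⟩ := h1 s hsD
    exact ⟨i, by simpa using hi, by rw [h]; rfl⟩
  · obtain ⟨i, hi, -⟩ := h2 s hs hsD
    simp at hi

/-- Phase II starts with the sites of `level u j`, and all letters set otherwise, in either phase,
exceed `j`. That no particle passes a free site is the `max 0` in the recursion. -/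
theorem transmits_level (q : Queue n) (u : Word n) {j : ℕ} (hc : (level u j).card ≤ q.card) :
    Transmits (level u j) q (level (queueAct q u) j) := by
  obtain ⟨L, L', h, hL, hL', hlen, -, -⟩ := exists_siteOrder_eq_append u j
  have ht : (siteOrder u).take q.card = L ++ L'.take (q.card - L.length) := by
    rw [h, List.take_append, List.take_of_length_le (hlen ▸ hc)]
  obtain ⟨D, hD, ⟨W, hW0, hW, hWq⟩, h1, h2, -⟩ := exists_phaseTwo_prefix q u ht
  have hlev : level (queueAct q u) j = D := by
    ext s
    rw [mem_level]
    by_cases hsD : s ∈ D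
    · obtain ⟨i, hi, h⟩ := h1 s hsD
      rw [← List.mem_toFinset, hL, mem_level] at hi
      simp [hsD, h, hi]
    · simp only [hsD, iff_false, not_le]
      by_cases hs : s ∈ q
      · obtain ⟨i, hi, h⟩ := h2 s hs hsD
        have := List.mem_of_mem_take hi
        rw [← List.mem_toFinset, hL', Finset.mem_compl, mem_level] at this
        rw [h]; omega
      · obtain ⟨i, hi, h⟩ := queueAct_of_notMem q u hs
        have := mem_drop_siteOrder hc hi
        rw [h, PNat.add_coe]; omega
  rw [hlev]
  rw [hL] at hW
  refine ⟨W, Or.inl fun i => ⟨?_, hW i⟩⟩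
  have := hW i; have := hW0 i; have := hW0 (i - 1); have := hWq i
  have := @hD i
  rcases chi_cases D i with h1 | h1 <;> rcases chi_cases q i with h2 | h2 <;>
    rcases chi_cases (level u j) i with h3 | h3 <;>
      simp only [h1.1, h2.1, h3.1, h1.2, h2.2, h3.2, not_true, not_false_eq_true,
        forall_const, imp_false] at * <;>
      omega

/-- Phase I starts with the sites outside `level u j`. Their letters exceed `j` and are increased by
one, whence the index `j + 1`; all other letters of the image are at most `j + 1`. -/
theorem transmits_level_succ (q : Queue n) (u : Word n) {j : ℕ}
    (hc : q.card ≤ (level u j).card) :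
    Transmits (level u j) q (level (queueAct q u) (j + 1)) := by
  obtain ⟨L, L', h, hL, hL', hlen, -, -⟩ := exists_siteOrder_eq_append u j
  have ht : ((siteOrder u).drop q.card).reverse = L'.reverse ++ (L.drop q.card).reverse := by
    rw [h, List.drop_append_of_le_length (hlen ▸ hc), List.reverse_append]
  obtain ⟨D, hD, ⟨W, hW0, hW, hWq⟩, h1, h2, -⟩ := exists_phaseOne_prefix q u ht
  obtain ⟨_, -, -, -, -, h3⟩ := exists_phaseTwo_prefix q u (List.append_nil _).symm
  rw [ht] at h3
  have hlev : level (queueAct q u) (j + 1) = Dᶜ := by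
    ext s
    rw [mem_level, Finset.mem_compl]
    by_cases hsD : s ∈ D
    · simp only [hsD, not_true, iff_false, not_le]
      obtain ⟨i, hi, h⟩ := h1 s hsD
      rw [List.mem_reverse, ← List.mem_toFinset, hL', Finset.mem_compl, mem_level] at hi
      rw [h3 s (Finset.mem_compl.1 (hD hsD)), h, Option.getD_some, PNat.add_coe, PNat.one_coe]
      omega
    · simp only [hsD, not_false_eq_true, iff_true]
      by_cases hs : s ∈ q
      · obtain ⟨i, hi, h⟩ := queueAct_of_mem q u hs
        have := mem_take_siteOrder hc hi
        rw [h]; omega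
      · obtain ⟨i, hi, h⟩ := h2 s hs hsD
        have := List.mem_of_mem_drop (List.mem_reverse.1 hi)
        rw [← List.mem_toFinset, hL, mem_level] at this
        rw [h3 s hs, h, Option.getD_some, PNat.add_coe, PNat.one_coe]
        omega
  rw [hlev]
  rw [List.toFinset_reverse, hL'] at hW
  -- In the parking process `W i` counts the holes leaving `i` to the left, whereas `FlowLeft`
  -- indexes the bond between `i` and `i + 1`.
  refine ⟨fun i => W (i + 1), Or.inr fun i => ?_⟩
  have := hW i; have := hW0 i; have := hW0 (i + 1); have := hWq i
  have := @hD i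
  simp only [chi_compl, sub_add_cancel] at *
  rcases chi_cases D i with h1 | h1 <;> rcases chi_cases q i with h2 | h2 <;>
    rcases chi_cases (level u j) i with h3 | h3 <;>
      simp only [h1.1, h2.1, h3.1, h1.2, h2.2, h3.2, Finset.mem_compl, not_true, not_false_eq_true,
        forall_const, imp_false] at * <;>
      omega

theorem subset_level_queueAct (q : Queue n) (u : Word n) {j : ℕ} (hc : q.card ≤ (level u j).card) :
    q ⊆ level (queueAct q u) j := by
  intro s hs
  obtain ⟨i, hi, h⟩ := queueAct_of_mem q u hs
  rw [mem_level, h]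
  exact mem_take_siteOrder hc hi

theorem level_queueAct_subset (q : Queue n) (u : Word n) {j : ℕ} (hc : (level u j).card ≤ q.card) :
    level (queueAct q u) (j + 1) ⊆ q := by
  intro s hs
  by_contra hsq
  obtain ⟨i, hi, h⟩ := queueAct_of_notMem q u hsq
  have := mem_drop_siteOrder hc hi
  rw [mem_level, h, PNat.add_coe, PNat.one_coe] at hs
  omega

theorem level_zero (u : Word n) : level u 0 = ∅ := by
  ext s
  simp [mem_level]

/-- The queue algorithm itself provides the flow, run on the word with letter 1 on `A` and 2
elsewhere. -/
theorem exists_transmits (A q : Finset (ZMod n)) : ∃ D, Transmits A q D := by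
  have hA : level (fun s => if s ∈ A then 1 else 2) 1 = A := by
    ext s
    by_cases hs : s ∈ A <;> simp [mem_level, hs]
  rcases le_total A.card q.card with hc | hc
  · have := transmits_level q (fun s => if s ∈ A then 1 else 2) (j := 1) (by rwa [hA])
    rw [hA] at this
    exact ⟨_, this⟩
  · have := transmits_level_succ q (fun s => if s ∈ A then 1 else 2) (j := 1) (by rwa [hA])
    rw [hA] at this
    exact ⟨_, this⟩

end QueueAction

end MLQ

namespace MLQ

/-! ### The Yang–Baxter equation and the interchange of two queues -/

section Interchange

variable {n : ℕ} [NeZero n]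

/-- The image of the set `A` under the queue `q`. -/
noncomputable def act (A q : Finset (ZMod n)) : Finset (ZMod n) :=
  Classical.choose (exists_transmits A q)

theorem transmits_act (A q : Finset (ZMod n)) : Transmits A q (act A q) :=
  Classical.choose_spec (exists_transmits A q)

/-- The set to which the queue `q` turns when the set `A` passes through it. -/
noncomputable def coact (A q : Finset (ZMod n)) : Finset (ZMod n) :=
  Classical.choose (transmits_act A q).exists_exchanges

theorem exchanges_coact (A q : Finset (ZMod n)) : Exchanges A q (coact A q) (act A q) :=
  Classical.choose_spec (transmits_act A q).exists_exchanges

theorem card_act (A q : Finset (ZMod n)) : (act A q).card = A.card := (exchanges_coact A q).card_eq.1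

theorem card_coact (A q : Finset (ZMod n)) : (coact A q).card = q.card :=
  (exchanges_coact A q).card_eq.2

theorem coact_coact (A q : Finset (ZMod n)) : coact (coact A q) (act A q) = A :=
  ((exchanges_coact _ _).unique (exchanges_coact A q).symm).1

theorem act_coact (A q : Finset (ZMod n)) : act (coact A q) (act A q) = q :=
  ((exchanges_coact _ _).unique (exchanges_coact A q).symm).2

theorem act_eq_of_card_eq {A q : Finset (ZMod n)} (h : A.card = q.card) : act A q = q :=
  (transmits_act A q).eq_of_card_eq h

/-- The exchange of the first two entries of a triple of sets. -/
noncomputable def exchFst (x : Queue n × Queue n × Queue n) : Queue n × Queue n × Queue n :=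
  (coact x.1 x.2.1, act x.1 x.2.1, x.2.2)

/-- The exchange of the last two entries of a triple of sets. -/
noncomputable def exchSnd (x : Queue n × Queue n × Queue n) : Queue n × Queue n × Queue n :=
  (x.1, coact x.2.1 x.2.2, act x.2.1 x.2.2)

theorem exchFst_exchFst (x : Queue n × Queue n × Queue n) : exchFst (exchFst x) = x := by
  simp [exchFst, coact_coact, act_coact]

theorem exchSnd_exchSnd (x : Queue n × Queue n × Queue n) : exchSnd (exchSnd x) = x := by
  simp [exchSnd, coact_coact, act_coact]

/-- The Yang–Baxter equation at a triple of sets. -/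
def YangBaxterAt (x : Queue n × Queue n × Queue n) : Prop :=
  exchFst (exchSnd (exchFst x)) = exchSnd (exchFst (exchSnd x))

/-- Both exchanges are involutions, so the equation is the braid relation, and it holds at a triple
as soon as it holds at a neighbour. -/
theorem yangBaxterAt_of_exchFst {x : Queue n × Queue n × Queue n}
    (h : YangBaxterAt (exchFst x)) : YangBaxterAt x := by
  unfold YangBaxterAt at *
  rw [exchFst_exchFst] at h
  rw [← exchSnd_exchSnd (exchFst (exchSnd (exchFst x))), ← h]

theorem yangBaxterAt_of_exchSnd {x : Queue n × Queue n × Queue n}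
    (h : YangBaxterAt (exchSnd x)) : YangBaxterAt x := by
  unfold YangBaxterAt at *
  rw [exchSnd_exchSnd] at h
  rw [← exchFst_exchFst (exchSnd (exchFst (exchSnd x))), h]

/-- The last components agree by the comparison of currents. The first ones agree by the same result
for the complements, taken in the reverse order, which again have increasing sizes. The middle ones
then agree because exchanges preserve the sum of the three indicators. -/
theorem yangBaxterAt_of_card_le (A q₁ q₂ : Queue n) (h1 : A.card ≤ q₁.card)
    (h2 : q₁.card ≤ q₂.card) : YangBaxterAt (A, q₁, q₂) := by
  have e1 := exchanges_coact A q₁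
  have e2 := exchanges_coact (act A q₁) q₂
  have e3 := exchanges_coact (coact A q₁) (coact (act A q₁) q₂)
  have f1 := exchanges_coact q₁ q₂
  have f2 := exchanges_coact A (coact q₁ q₂)
  have f3 := exchanges_coact (act A (coact q₁ q₂)) (act q₁ q₂)
  have hlast := transmits_interchange_of_card_le f1 e1.1 e2.1 f2.1 f3.1 h2 h1
  have hfirst := transmits_interchange_of_card_le e1.compl f1.compl.1 f2.compl.1 e2.compl.1
    e3.compl.1 (by simp only [Finset.card_compl]; omega) (by simp only [Finset.card_compl]; omega)
  rw [compl_inj_iff] at hfirst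
  simp only [YangBaxterAt, exchFst, exchSnd, Prod.mk.injEq]
  refine ⟨hfirst.symm, eq_of_chi_eq fun i => ?_, hlast⟩
  have := e1.2 i; have := e2.2 i; have := e3.2 i
  have := f1.2 i; have := f2.2 i; have := f3.2 i
  rw [← hfirst, ← hlast] at *
  omega

/-- Each exchange swaps two adjacent sizes, so exchanges sort any triple by size. -/
theorem yangBaxterAt (x : Queue n × Queue n × Queue n) : YangBaxterAt x := by
  have h3 (A q₁ q₂ : Queue n) (h : A.card ≤ q₁.card) (h' : A.card ≤ q₂.card) :
      YangBaxterAt (A, q₁, q₂) := by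
    rcases le_total q₁.card q₂.card with h2 | h2
    · exact yangBaxterAt_of_card_le _ _ _ h h2
    · exact yangBaxterAt_of_exchSnd (yangBaxterAt_of_card_le _ _ _ (by rwa [card_coact])
        (by rwa [card_coact, card_act]))
  have h2 (A q₁ q₂ : Queue n) (h : q₁.card ≤ q₂.card) : YangBaxterAt (A, q₁, q₂) := by
    rcases le_total A.card q₁.card with h1 | h1
    · exact h3 _ _ _ h1 (h1.trans h)
    · exact yangBaxterAt_of_exchFst (h3 _ _ _ (by rwa [card_coact, card_act])
        (by rwa [card_coact]))
  obtain ⟨A, q₁, q₂⟩ := x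
  rcases le_total q₁.card q₂.card with h | h
  · exact h2 _ _ _ h
  · exact yangBaxterAt_of_exchSnd (h2 _ _ _ (by rwa [card_coact, card_act]))

theorem act_act (A q₁ q₂ : Queue n) :
    act (act A (coact q₁ q₂)) (act q₁ q₂) = act (act A q₁) q₂ :=
  (congrArg (fun x => x.2.2) (yangBaxterAt (A, q₁, q₂))).symm

/-- The level set of `q(u)` in terms of two consecutive level sets of `u`. -/
noncomputable def levelAct (q X Y : Finset (ZMod n)) : Finset (ZMod n) :=
  if Y.card ≤ q.card then act Y q else if X.card ≤ q.card then q else act X q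

theorem levelAct_of_card_le {q X Y : Finset (ZMod n)} (h : Y.card ≤ q.card) :
    levelAct q X Y = act Y q := if_pos h

theorem levelAct_of_le_card_of_card_le {q X Y : Finset (ZMod n)} (h : X.card ≤ q.card)
    (h' : q.card ≤ Y.card) : levelAct q X Y = q := by
  unfold levelAct
  split_ifs with h1
  · exact act_eq_of_card_eq (le_antisymm h1 h')
  · rfl

theorem levelAct_of_le_card {q X Y : Finset (ZMod n)} (hXY : X.card ≤ Y.card)
    (h : q.card ≤ X.card) : levelAct q X Y = act X q := by
  rcases h.eq_or_lt with h' | h'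
  · rw [levelAct_of_le_card_of_card_le h'.ge (h.trans hXY), act_eq_of_card_eq h'.symm]
  · rw [levelAct, if_neg (by omega), if_neg (by omega)]

/-- The cases place the two queue sizes among those of `X, Y, Z`. If one set passes through both
queues, this is `act_act`. If a queue enters as a level set, the other queue either acts on it,
where `act q₁ q₂` and `act_coact` match the two sides, or comes later in size and is not affected.
-/
theorem levelAct_levelAct_of_card_le {q₁ q₂ X Y Z : Finset (ZMod n)} (hXY : X.card ≤ Y.card)
    (hYZ : Y.card ≤ Z.card) (hq : q₁.card ≤ q₂.card) :
    levelAct q₂ (levelAct q₁ X Y) (levelAct q₁ Y Z) =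
      levelAct (act q₁ q₂) (levelAct (coact q₁ q₂) X Y) (levelAct (coact q₁ q₂) Y Z) := by
  have c1 := card_coact q₁ q₂
  have c2 := card_act q₁ q₂
  rcases le_total Z.card q₁.card with h | hZ
  · rw [levelAct_of_card_le (q := q₁) (Y := Z) h, levelAct_of_card_le (Y := Z) (by omega),
      levelAct_of_card_le (by rw [card_act]; omega),
      levelAct_of_card_le (by rw [card_act, card_act]; omega), act_act]
  rcases le_total Y.card q₁.card with h | hY
  · rw [levelAct_of_card_le (q := q₁) (Y := Y) h, levelAct_of_le_card_of_card_le (q := q₁) h hZ,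
      levelAct_of_card_le (Y := q₁) hq, levelAct_of_card_le (Y := Y) (by omega)]
    rcases le_total Z.card q₂.card with h' | h'
    · rw [levelAct_of_card_le (Y := Z) (by omega),
        levelAct_of_le_card_of_card_le (by rw [card_act]; omega) (by rw [card_act, card_act]; omega)]
    · rw [levelAct_of_le_card_of_card_le (q := coact q₁ q₂) (by omega) (by omega),
        levelAct_of_le_card_of_card_le (by rw [card_act]; omega) (by omega)]
  rw [levelAct_of_le_card (q := q₁) (X := Y) hYZ hY]
  rcases le_total Y.card q₂.card with h' | h'
  · have hc : Y.card ≤ (levelAct (coact q₁ q₂) Y Z).card := by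
      rcases le_total Z.card q₂.card with h | h
      · rw [levelAct_of_card_le (by omega), card_act]; omega
      · rw [levelAct_of_le_card_of_card_le (by omega) (by omega)]; omega
    rw [levelAct_of_card_le (Y := act Y q₁) (by rw [card_act]; omega),
      levelAct_of_card_le (Y := Y) (by omega), levelAct_of_le_card (by rwa [card_act])
      (by simp only [card_act]; omega), act_act]
  rw [levelAct_of_le_card (q := coact q₁ q₂) (X := Y) hYZ (by omega)]
  rcases le_total X.card q₂.card with hX | hX
  · have hc : (levelAct q₁ X Y).card ≤ q₂.card := by
      rcases le_total X.card q₁.card with h | h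
      · rwa [levelAct_of_le_card_of_card_le h hY]
      · rwa [levelAct_of_le_card hXY h, card_act]
    rw [levelAct_of_le_card_of_card_le hc (by rwa [card_act]),
      levelAct_of_le_card_of_card_le (q := coact q₁ q₂) (by omega) (by omega),
      levelAct_of_le_card (by rw [card_act]; omega) (by omega), act_coact]
  · rw [levelAct_of_le_card (q := q₁) hXY (by omega),
      levelAct_of_le_card (q := coact q₁ q₂) hXY (by omega),
      levelAct_of_le_card (q := q₂) (by rwa [card_act, card_act]) (by rwa [card_act]),
      levelAct_of_le_card (by rwa [card_act, card_act]) (by simp only [card_act]; omega), act_act]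

theorem levelAct_levelAct {q₁ q₂ X Y Z : Finset (ZMod n)} (hXY : X.card ≤ Y.card)
    (hYZ : Y.card ≤ Z.card) :
    levelAct q₂ (levelAct q₁ X Y) (levelAct q₁ Y Z) =
      levelAct (act q₁ q₂) (levelAct (coact q₁ q₂) X Y) (levelAct (coact q₁ q₂) Y Z) := by
  rcases le_total q₁.card q₂.card with h | h
  · exact levelAct_levelAct_of_card_le hXY hYZ h
  · have := levelAct_levelAct_of_card_le (q₁ := coact q₁ q₂) (q₂ := act q₁ q₂) hXY hYZ
      (by rwa [card_coact, card_act])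
    rw [coact_coact, act_coact] at this
    exact this.symm

theorem level_mono (u : Word n) {j k : ℕ} (h : j ≤ k) : level u j ⊆ level u k := fun s hs => by
  rw [mem_level] at *
  omega

theorem level_queueAct (q : Queue n) (u : Word n) (j : ℕ) :
    level (queueAct q u) j = levelAct q (level u (j - 1)) (level u j) := by
  rcases le_total (level u j).card q.card with h | h
  · rw [levelAct_of_card_le h]
    exact (transmits_level q u h).unique (transmits_act _ _)
  -- At `j = 0` the truncated `j - 1` is harmless: the level set is empty and so is its image.
  rcases j with _ | j
  · rw [level_zero] at h ⊢
    rw [levelAct_of_card_le (by simp [level_zero]), eq_comm, ← Finset.card_eq_zero, card_act]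
    simp [level_zero]
  rw [Nat.add_sub_cancel]
  rcases le_total (level u j).card q.card with h' | h'
  · rw [levelAct_of_le_card_of_card_le h' h]
    exact (level_queueAct_subset q u h').antisymm (subset_level_queueAct q u h)
  · rw [levelAct_of_le_card (Finset.card_le_card (level_mono u (Nat.le_succ j))) h']
    exact (transmits_level_succ q u h').unique (transmits_act _ _)

theorem eq_of_level_eq {u v : Word n} (h : ∀ j, level u j = level v j) : u = v := by
  funext s
  refine PNat.coe_injective (le_antisymm ?_ ?_)
  · rw [← mem_level, h, mem_level]
  · rw [← mem_level, ← h, mem_level]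

/-- Two consecutive queues can be interchanged, with an exchange of their sizes. -/
theorem queueAct_queueAct (q₁ q₂ : Queue n) (u : Word n) :
    queueAct (act q₁ q₂) (queueAct (coact q₁ q₂) u) = queueAct q₂ (queueAct q₁ u) :=
  eq_of_level_eq fun j => by
    simp only [level_queueAct]
    exact (levelAct_levelAct (Finset.card_le_card (level_mono u (by omega)))
      (Finset.card_le_card (level_mono u (by omega)))).symm

theorem queueWeight_coact_mul_act (q₁ q₂ : Queue n) :
    queueWeight (coact q₁ q₂) * queueWeight (act q₁ q₂) = queueWeight q₁ * queueWeight q₂ := by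
  have h : (coact q₁ q₂).val + (act q₁ q₂).val = q₁.val + q₂.val := by
    ext i
    have := (exchanges_coact q₁ q₂).2 i
    simp only [Multiset.count_add, Multiset.count_eq_of_nodup (Finset.nodup _), Finset.mem_val]
    simp only [chi] at this
    split_ifs at * <;> omega
  simp only [queueWeight, Finset.prod]
  rw [← Multiset.prod_add, ← Multiset.map_add, h, Multiset.map_add, Multiset.prod_add]

end Interchange

/-! ### Weighted sums over sequences of queues -/

section SequenceSums

variable {n : ℕ} [NeZero n]

/-- The weighted sum of the values of `φ` at the images of the word `u` under all sequences of
queues with the sizes in the list. -/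
noncomputable def seqSum (φ : Word n → MvPolynomial (ZMod n) ℤ) :
    List ℕ → Word n → MvPolynomial (ZMod n) ℤ
  | [], u => φ u
  | c :: L, u => ∑ q ∈ Finset.powersetCard c Finset.univ, queueWeight q * seqSum φ L (queueAct q u)

theorem seqSum_swap (φ : Word n → MvPolynomial (ZMod n) ℤ) (c d : ℕ) (L : List ℕ) (u : Word n) :
    seqSum φ (c :: d :: L) u = seqSum φ (d :: c :: L) u := by
  simp only [seqSum, Finset.mul_sum]
  rw [← Finset.sum_product', ← Finset.sum_product']
  refine Finset.sum_nbij' (fun x => (coact x.1 x.2, act x.1 x.2))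
    (fun x => (coact x.1 x.2, act x.1 x.2)) ?_ ?_ ?_ ?_ ?_
  · rintro ⟨q₁, q₂⟩ h
    simpa [card_act, card_coact, and_comm] using h
  · rintro ⟨q₁, q₂⟩ h
    simpa [card_act, card_coact, and_comm] using h
  · rintro ⟨q₁, q₂⟩ -
    simp [coact_coact, act_coact]
  · rintro ⟨q₁, q₂⟩ -
    simp [coact_coact, act_coact]
  · rintro ⟨q₁, q₂⟩ -
    dsimp only
    rw [queueAct_queueAct, ← mul_assoc, ← mul_assoc, queueWeight_coact_mul_act]

theorem seqSum_perm (φ : Word n → MvPolynomial (ZMod n) ℤ) {L L' : List ℕ} (h : L.Perm L') :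
    ∀ u, seqSum φ L u = seqSum φ L' u := by
  induction h with
  | nil => exact fun _ => rfl
  | cons c _ ih => intro u; simp only [seqSum, ih]
  | swap c d L => exact fun u => seqSum_swap φ d c L u
  | trans _ _ ih ih' => exact fun u => (ih u).trans (ih' u)

theorem sum_seqSum {ι : Type*} (S : Finset ι) (φ : ι → Word n → MvPolynomial (ZMod n) ℤ)
    (L : List ℕ) : ∀ u, ∑ x ∈ S, seqSum (φ x) L u = seqSum (fun w => ∑ x ∈ S, φ x w) L u := by
  induction L with
  | nil => exact fun _ => rfl
  | cons c L ih =>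
    intro u
    simp only [seqSum]
    rw [Finset.sum_comm]
    simp only [← Finset.mul_sum, ih]

theorem sum_filter_seqAct (φ : Word n → MvPolynomial (ZMod n) ℤ) {k : ℕ} (c : Fin k → ℕ) :
    ∀ u, ∑ q ∈ Finset.univ.filter (fun q : Fin k → Queue n => ∀ i, (q i).card = c i),
      (∏ i, queueWeight (q i)) * φ (seqAct q u) = seqSum φ (List.ofFn c) u := by
  induction k with
  | zero => intro u; simp [seqSum, seqAct]
  | succ k ih =>
    intro u
    rw [Finset.sum_filter, ← (Fin.consEquiv (fun _ => Queue n)).sum_comp, Fintype.sum_prod_type,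
      List.ofFn_succ, seqSum]
    have hp : Finset.powersetCard (c 0) Finset.univ =
        Finset.univ.filter (fun q : Queue n => q.card = c 0) := by
      ext q; simp
    rw [hp, Finset.sum_filter]
    refine Finset.sum_congr rfl fun r _ => ?_
    rw [← ih (fun i => c i.succ), Finset.sum_filter, Finset.mul_sum]
    by_cases hr : r.card = c 0
    · rw [if_pos hr]
      refine Finset.sum_congr rfl fun q _ => ?_
      simp only [Fin.consEquiv_apply, Fin.forall_fin_succ, Fin.cons_zero, Fin.cons_succ, hr,
        true_and, Fin.prod_univ_succ, mul_ite, mul_zero, mul_assoc, seqAct, List.ofFn_succ,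
        List.foldl_cons]
    · rw [if_neg hr]
      exact Finset.sum_eq_zero fun q _ => if_neg fun h => hr (h 0)

end SequenceSums

end MLQ

namespace MLQ

/-! ### Partial sums of types -/

section PartialSums

/-- The sum of the first `k` entries of a vector. -/
def psum (m : TypeVec) (k : ℕ) : ℕ := ∑ i ∈ Finset.range k, m i.succPNat

theorem psum_succ (m : TypeVec) (k : ℕ) : psum m (k + 1) = psum m k + m k.succPNat :=
  Finset.sum_range_succ _ _

theorem psum_mono (m : TypeVec) : Monotone (psum m) :=
  monotone_nat_of_le_succ fun k => by rw [psum_succ]; omega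

theorem partialSum_eq_psum (m : TypeVec) (j : ℕ+) : partialSum m j = psum m j := by
  refine (Finset.sum_nbij' Nat.succPNat PNat.natPred ?_ ?_ ?_ ?_ ?_).symm
  · intro i hi
    rw [Finset.mem_range] at hi
    rw [Finset.mem_Icc, ← PNat.coe_le_coe, ← PNat.coe_le_coe, Nat.succPNat_coe, PNat.one_coe]
    omega
  · intro i hi
    rw [Finset.mem_Icc, ← PNat.coe_le_coe, ← PNat.coe_le_coe] at hi
    have := PNat.natPred_add_one i
    rw [Finset.mem_range]
    omega
  · intro i _; simp
  · intro i _; simp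
  · intro i _; rfl

theorem succPNat_natPred_add_one (t : ℕ+) : (t : ℕ).succPNat = t + 1 := PNat.eq (by simp)

theorem psum_coe (m : TypeVec) (t : ℕ+) : psum m t = psum m (t.natPred) + m t := by
  rw [← PNat.natPred_add_one t, psum_succ, PNat.succPNat_natPred]

theorem psum_coe_add_one (m : TypeVec) (t : ℕ+) : psum m (t + 1) = psum m t + m (t + 1) := by
  rw [psum_succ, succPNat_natPred_add_one]

theorem eq_of_psum_eq {m m' : TypeVec} (h : ∀ k, psum m k = psum m' k) : m = m' := by
  funext t
  have h1 := h t
  rw [psum_coe, psum_coe, h] at h1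
  omega

theorem psum_mergeType (t : ℕ+) (m : TypeVec) (k : ℕ) :
    psum (mergeType t m) k = if k < t then psum m k else psum m (k + 1) := by
  induction k with
  | zero => simp [psum]
  | succ k ih =>
    rw [psum_succ, ih, mergeType]
    simp only [← PNat.coe_lt_coe, ← PNat.coe_inj, Nat.succPNat_coe, Nat.succ_eq_add_one]
    rcases lt_trichotomy (k + 1) t with h | h | h
    · simp [h, Nat.lt_of_succ_lt h, psum_succ]
    · have ht : t = k.succPNat := PNat.eq (by simp [← h])
      subst ht
      simp only [Nat.succPNat_coe, Nat.succ_eq_add_one, Nat.lt_succ_self, if_true, lt_irrefl, if_false]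
      rw [psum_succ m (k + 1), psum_succ, add_assoc]
      congr 2
    · rw [if_neg (by omega), if_neg (by omega), if_neg (by omega), if_neg (by omega),
        psum_succ m (k + 1)]
      congr 2

end PartialSums

/-! ### Merging of classes as omission of a level set -/

section Merging

variable {n : ℕ} [NeZero n]

theorem card_level (u : Word n) (k : ℕ) : (level u k).card = psum (wordType u) k := by
  induction k with
  | zero => simp [level_zero, psum]
  | succ k ih =>
    have h : level u (k + 1) = level u k ∪ Finset.univ.filter (fun s => u s = k.succPNat) := by
      ext s
      simp only [mem_level, Finset.mem_union, Finset.mem_filter, Finset.mem_univ, true_and,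
        ← PNat.coe_inj, Nat.succPNat_coe]
      omega
    rw [h, Finset.card_union_of_disjoint, ih, psum_succ, wordType]
    rw [Finset.disjoint_left]
    intro s hs
    simp only [mem_level, Finset.mem_filter, Finset.mem_univ, true_and, ← PNat.coe_inj,
      Nat.succPNat_coe] at hs ⊢
    omega

omit [NeZero n] in
theorem coe_merge (t : ℕ+) (u : Word n) (s : ZMod n) :
    (merge t u s : ℕ) = if (t : ℕ) < u s then (u s : ℕ) - 1 else u s := by
  have ht := t.pos
  unfold merge
  simp only [← PNat.coe_lt_coe]
  split_ifs with h
  · rw [PNat.sub_coe, if_pos (by rw [← PNat.coe_lt_coe, PNat.one_coe]; omega), PNat.one_coe]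
  · rfl

theorem level_merge (t : ℕ+) (u : Word n) (j : ℕ) :
    level (merge t u) j = if j < t then level u j else level u (j + 1) := by
  ext s
  split_ifs with h <;> rw [mem_level, mem_level, coe_merge] <;> split_ifs <;> omega

theorem wordType_merge (t : ℕ+) (u : Word n) :
    wordType (merge t u) = mergeType t (wordType u) :=
  eq_of_psum_eq fun k => by
    rw [← card_level, level_merge, psum_mergeType]
    split_ifs <;> rw [card_level]

/-- The word `w` arises from `u` by the omission of a level set with `P` elements. -/
def OmitsLevel (P : ℕ) (u w : Word n) : Prop := ∃ t : ℕ, (level u t).card = P ∧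
  (∀ j < t, level w j = level u j) ∧ ∀ j, t ≤ j → level w j = level u (j + 1)

/-- The omitted level set is transported like any other: its index stays if it is not larger than
`q`, and rises by one otherwise. Only the neighbouring index needs care, since the image of a level
set depends on its predecessor, which differs there between `u` and `w`. -/
theorem OmitsLevel.queueAct {P : ℕ} {u w : Word n} (h : OmitsLevel P u w) (q : Queue n) :
    OmitsLevel P (queueAct q u) (queueAct q w) := by
  obtain ⟨t, hP, h1, h2⟩ := h
  have mono {j k : ℕ} (h : j ≤ k) : (level u j).card ≤ (level u k).card :=
    Finset.card_le_card (level_mono u h)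
  rcases le_total P q.card with hc | hc
  · refine ⟨t, ?_, fun j hj => ?_, fun j hj => ?_⟩
    · rw [level_queueAct, levelAct_of_card_le (hP.trans_le hc), card_act, hP]
    · rw [level_queueAct, level_queueAct, h1 j hj, h1 (j - 1) (by omega)]
    · rw [level_queueAct, level_queueAct, h2 j hj, Nat.add_sub_cancel]
      rcases hj.eq_or_lt with rfl | hj
      · have hw : (level w (t - 1)).card ≤ q.card := by
          rcases Nat.eq_zero_or_pos t with rfl | ht
          · rw [level_zero]; simp
          · rw [h1 _ (by omega)]
            exact (mono (by omega)).trans (hP.trans_le hc)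
        unfold levelAct
        rw [if_pos hw, if_pos (hP.trans_le hc)]
      · rw [h2 (j - 1) (by omega), Nat.sub_add_cancel (by omega)]
  · refine ⟨t + 1, ?_, fun j hj => ?_, fun j hj => ?_⟩
    · rw [level_queueAct, Nat.add_sub_cancel, levelAct_of_le_card (mono (by omega)) (by omega),
        card_act, hP]
    · rw [level_queueAct, level_queueAct]
      rcases (Nat.lt_succ_iff.1 hj).eq_or_lt with rfl | hj
      · have hw : level w (j - 1) = level u (j - 1) := by
          rcases Nat.eq_zero_or_pos j with rfl | ht
          · rw [level_zero, level_zero]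
          · exact h1 _ (by omega)
        rw [hw, h2 j le_rfl]
        rcases le_total (level u (j - 1)).card q.card with h | h
        · rw [levelAct_of_le_card_of_card_le h (by have := mono (show j ≤ j + 1 by omega); omega),
            levelAct_of_le_card_of_card_le h (by omega)]
        · rw [levelAct_of_le_card (mono (by omega)) h, levelAct_of_le_card (mono (by omega)) h]
      · rw [h1 j hj, h1 (j - 1) (by omega)]
    · rw [level_queueAct, level_queueAct, h2 j (by omega), h2 (j - 1) (by omega),
        Nat.sub_add_cancel (by omega), Nat.add_sub_cancel]

theorem level_one (j : ℕ) (hj : j ≠ 0) : level (fun _ : ZMod n => 1) j = Finset.univ := by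
  ext s
  simp [mem_level]
  omega

/-- The image of `1ⁿ` has the level sets `∅, q`, and then all sites. -/
theorem omitsLevel_queueAct_one (q : Queue n) :
    OmitsLevel q.card (queueAct q (fun _ => 1)) (fun _ => 1) := by
  have hle : q.card ≤ (Finset.univ : Finset (ZMod n)).card := Finset.card_le_univ q
  refine ⟨1, ?_, fun j hj => ?_, fun j hj => ?_⟩
  · rw [level_queueAct, Nat.sub_self, level_zero, level_one 1 one_ne_zero,
      levelAct_of_le_card_of_card_le (by simp) hle]
  · rw [Nat.lt_one_iff.1 hj, level_zero, level_zero]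
  · rw [level_queueAct, Nat.add_sub_cancel, level_one j (by omega), level_one (j + 1) (by omega),
      levelAct_of_le_card le_rfl hle, eq_comm]
    exact Finset.eq_univ_of_card _ (by rw [card_act, Finset.card_univ])

theorem seqSum_eq_of_omitsLevel {P : ℕ} {φ ψ : Word n → MvPolynomial (ZMod n) ℤ}
    (h : ∀ u w, OmitsLevel P u w → φ u = ψ w) (L : List ℕ) :
    ∀ {u w : Word n}, OmitsLevel P u w → seqSum φ L u = seqSum ψ L w := by
  induction L with
  | nil => exact fun h' => h _ _ h'
  | cons c L ih =>
    intro u w h'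
    exact Finset.sum_congr rfl fun q _ => by rw [ih (h'.queueAct q)]

theorem OmitsLevel.type_eq_and_eq_merge_iff {t : ℕ+} {m : TypeVec} (ht : m t ≠ 0)
    (ht' : m (t + 1) ≠ 0) {v : Word n} (hv : wordType v = mergeType t m) {u w : Word n}
    (h : OmitsLevel (psum m t) u w) : (wordType u = m ∧ v = merge t u) ↔ v = w := by
  obtain ⟨k, hP, h1, h2⟩ := h
  rw [card_level] at hP
  have e1 := psum_coe m t
  have e2 := psum_coe_add_one m t
  have e3 := PNat.natPred_add_one t
  constructor
  · rintro ⟨rfl, rfl⟩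
    -- As `m t` and `m (t + 1)` are nonzero, `t` is the only index with partial sum `psum m t`, so
    -- the size identifies the omitted level.
    have hk : k = t := by
      rcases lt_trichotomy k t with h | h | h
      · have := psum_mono (wordType u) (show k ≤ t.natPred by omega)
        omega
      · exact h
      · have := psum_mono (wordType u) (show (t : ℕ) + 1 ≤ k by omega)
        omega
    subst hk
    refine eq_of_level_eq fun j => ?_
    rw [level_merge]
    split_ifs with hj
    · rw [h1 j hj]
    · rw [h2 j (by omega)]
  · rintro rfl
    have f1 (j : ℕ) (hj : j < k) : psum (wordType u) j = if j < t then psum m j else psum m (j + 1) := by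
      rw [← card_level, ← h1 j hj, card_level, hv, psum_mergeType]
    have f2 (j : ℕ) (hj : k ≤ j) :
        psum (wordType u) (j + 1) = if j < t then psum m j else psum m (j + 1) := by
      rw [← card_level, ← h2 j hj, card_level, hv, psum_mergeType]
    have hk : k = t := by
      rcases lt_trichotomy k t with h | h | h
      · have h3 := f2 k le_rfl
        rw [if_pos h] at h3
        have := psum_mono m (show k ≤ t.natPred by omega)
        have := psum_mono (wordType u) (Nat.le_succ k)
        simp only [Nat.succ_eq_add_one] at this
        omega
      · exact h
      · have h3 := f1 (k - 1) (by omega)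
        rw [if_neg (by omega), Nat.sub_add_cancel (by omega)] at h3
        have := psum_mono m (show (t : ℕ) + 1 ≤ k by omega)
        have := psum_mono (wordType u) (Nat.sub_le k 1)
        omega
    subst hk
    refine ⟨eq_of_psum_eq fun j => ?_, eq_of_level_eq fun j => ?_⟩
    · rcases lt_trichotomy j t with h | h | h
      · rw [f1 j h, if_pos h]
      · rw [h, hP]
      · have := f2 (j - 1) (by omega)
        rwa [if_neg (by omega), Nat.sub_add_cancel (by omega)] at this
    · rw [level_merge]
      split_ifs with hj
      · rw [h1 j hj]
      · rw [h2 j (by omega)]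

end Merging

/-! ### Spectral weights and the merging formula -/

section SpectralWeight

variable {n : ℕ} [NeZero n]

theorem le_numClasses (u : Word n) (s : ZMod n) : u s ≤ numClasses u :=
  Finset.le_sup (f := u) (Finset.mem_univ s)

theorem wordType_eq_zero {u : Word n} {j : ℕ+} (h : numClasses u < j) : wordType u j = 0 := by
  rw [wordType, Finset.card_eq_zero, Finset.filter_eq_empty_iff]
  rintro s - rfl
  exact absurd (le_numClasses u s) (not_le.2 h)

theorem wordType_numClasses_ne_zero (u : Word n) : wordType u (numClasses u) ≠ 0 := by
  obtain ⟨s, -, hs⟩ := Finset.exists_mem_eq_sup Finset.univ Finset.univ_nonempty u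
  rw [wordType, Finset.card_ne_zero]
  exact ⟨s, by simp [numClasses, hs]⟩

theorem IsPacked.wordType_ne_zero_iff {u : Word n} (hu : IsPacked u) (j : ℕ+) :
    wordType u j ≠ 0 ↔ j ≤ numClasses u :=
  ⟨fun h => not_lt.1 fun h' => h (wordType_eq_zero h'), hu j⟩

theorem numClasses_eq_of_wordType {u : Word n} {l : ℕ+} (h : ∀ j, wordType u j ≠ 0 ↔ j ≤ l) :
    numClasses u = l :=
  le_antisymm ((h _).1 (wordType_numClasses_ne_zero u))
    (not_lt.1 fun h' => (h l).2 le_rfl (wordType_eq_zero h'))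

theorem spectralWeight_eq_seqSum (u : Word n) :
    spectralWeight u = seqSum (fun w => if w = u then 1 else 0)
      ((List.range (numClasses u).natPred).map (fun i => psum (wordType u) (i + 1)))
      (fun _ => 1) := by
  -- The condition on the last partial sum in `multilineQueues` always holds for the type of a word.
  have hn : partialSum (wordType u) (numClasses u).natPred.succPNat = n := by
    rw [PNat.succPNat_natPred, partialSum_eq_psum, ← card_level,
      Finset.card_eq_iff_eq_univ _ |>.2, ZMod.card]
    ext s
    simpa [mem_level] using le_numClasses u s
  have hL : (List.range (numClasses u).natPred).map (fun i => psum (wordType u) (i + 1)) =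
      List.ofFn (fun i : Fin (numClasses u).natPred => partialSum (wordType u) (Nat.succPNat i)) := by
    rw [List.ofFn_eq_map, ← List.map_coe_finRange_eq_range, List.map_map]
    refine List.map_congr_left fun i _ => ?_
    simp [partialSum_eq_psum]
  rw [hL, ← sum_filter_seqAct, spectralWeight, Finset.sum_filter, multilineQueues]
  simp only [hn, and_true, mul_ite, mul_one, mul_zero]

theorem perm_map_range {f g : ℕ → ℕ} {t : ℕ} (h1 : ∀ j < t, g j = f j)
    (h2 : ∀ j, t ≤ j → g j = f (j + 1)) {k : ℕ} (hk : t ≤ k) :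
    ((List.range (k + 1)).map f).Perm (f t :: (List.range k).map g) := by
  induction k, hk using Nat.le_induction with
  | base =>
    rw [List.range_succ, List.map_append, List.map_congr_left (g := g) fun j hj =>
      (h1 j (List.mem_range.1 hj)).symm]
    exact List.perm_append_singleton _ _
  | succ k hk ih =>
    rw [List.range_succ (n := k + 1), List.map_append, List.range_succ (n := k),
      List.map_append (f := g), List.map_singleton, List.map_singleton, h2 k hk,
      ← List.range_succ, ← List.cons_append]
    exact ih.append_right _

theorem mem_wordsOfType {m : TypeVec} {u : Word n} : u ∈ wordsOfType n m ↔ wordType u = m := by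
  simp [wordsOfType]

/-- Splitting a class of a packed word into two nonempty ones gives a packed type with one more
class, which fixes the number of queues for every `u` in the sum. -/
theorem ne_zero_iff_of_mergeType {t l : ℕ+} {m : TypeVec} (ht : m t ≠ 0) (ht' : m (t + 1) ≠ 0)
    (h : ∀ j, mergeType t m j ≠ 0 ↔ j ≤ l) (j : ℕ+) : m j ≠ 0 ↔ j ≤ l + 1 := by
  have htl : t ≤ l := (h t).1 (by simp [mergeType, ht])
  rcases lt_trichotomy j t with hj | rfl | hj
  · have := h j
    rw [mergeType, if_pos hj] at this
    rw [this]
    exact ⟨fun h => h.trans (PNat.lt_add_right l 1).le, fun _ => (hj.trans_le htl).le⟩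
  · exact iff_of_true ht (htl.trans (PNat.lt_add_right l 1).le)
  · have hj1 : j ≠ 1 := fun h1 => by
      rw [h1] at hj; exact absurd hj one_le.not_gt
    obtain ⟨i, rfl⟩ := PNat.exists_eq_succ_of_ne_one hj1
    rw [add_le_add_iff_right]
    rw [PNat.lt_add_one_iff] at hj
    rcases hj.eq_or_lt with rfl | hj
    · exact iff_of_true ht' htl
    · rw [← h i, mergeType, if_neg hj.not_gt, if_neg hj.ne']

theorem isPacked_of_mergeType {t : ℕ+} {m : TypeVec} (ht : m t ≠ 0) (ht' : m (t + 1) ≠ 0)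
    {v u : Word n} (hv : IsPacked v) (hvm : wordType v = mergeType t m) (hu : wordType u = m) :
    IsPacked u ∧ numClasses u = numClasses v + 1 := by
  have h : ∀ j, wordType u j ≠ 0 ↔ j ≤ numClasses v + 1 := by
    rw [hu]
    exact ne_zero_iff_of_mergeType ht ht' (by rw [← hvm]; exact hv.wordType_ne_zero_iff)
  have h' := numClasses_eq_of_wordType h
  exact ⟨fun j hj => (h j).2 (h' ▸ hj), h'⟩

/-- Merging of two classes. -/
theorem spectralWeight_mul_esymm {t : ℕ+} {m : TypeVec} (ht : m t ≠ 0) (ht' : m (t + 1) ≠ 0)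
    {v : Word n} (hv : IsPacked v) (hvm : wordType v = mergeType t m) :
    spectralWeight v * MvPolynomial.esymm (ZMod n) ℤ (psum m t) =
      ∑ u ∈ (wordsOfType n m).filter (fun u => v = merge t u), spectralWeight u := by
  obtain ⟨L, hL⟩ : ∃ L, L = (List.range (numClasses v).natPred).map
    (fun i => psum (wordType v) (i + 1)) := ⟨_, rfl⟩
  have htl : t ≤ numClasses v := by
    rw [← hv.wordType_ne_zero_iff, hvm]
    simp [mergeType, ht]
  have hperm (u : Word n) (hu : wordType u = m) :
      spectralWeight u = seqSum (fun w => if w = u then 1 else 0) (psum m t :: L) (fun _ => 1) := by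
    have e1 := PNat.natPred_add_one t
    have e2 := PNat.natPred_add_one (numClasses v)
    rw [spectralWeight_eq_seqSum, (isPacked_of_mergeType ht ht' hv hvm hu).2, hu, hL, hvm,
      show (numClasses v + 1).natPred = (numClasses v).natPred + 1 by
        rw [PNat.natPred, PNat.add_coe, PNat.one_coe]; omega]
    have := perm_map_range (f := fun i => psum m (i + 1)) (t := t.natPred)
      (g := fun i => psum (mergeType t m) (i + 1))
      (fun j hj => by rw [psum_mergeType, if_pos (by omega)])
      (fun j hj => by rw [psum_mergeType, if_neg (by omega)])
      (k := (numClasses v).natPred) (by rw [← PNat.coe_le_coe] at htl; omega)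
    rw [e1] at this
    exact seqSum_perm _ this _
  rw [Finset.sum_congr rfl fun u hu => hperm u (mem_wordsOfType.1 (Finset.mem_filter.1 hu).1),
    sum_seqSum, seqSum, spectralWeight_eq_seqSum v, ← hL, MvPolynomial.esymm, Finset.mul_sum]
  refine Finset.sum_congr rfl fun q hq => ?_
  rw [Finset.mem_powersetCard] at hq
  rw [mul_comm]
  congr 1
  -- After the first queue `q`, the remaining sizes `L` are those for `v`. They act in parallel on
  -- `q(1ⁿ)` and on `1ⁿ`, and the two indicator functions agree on the results.
  refine (seqSum_eq_of_omitsLevel (P := psum m t) (fun u w huw => ?_) L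
    (hq.2 ▸ omitsLevel_queueAct_one q)).symm
  have := huw.type_eq_and_eq_merge_iff ht ht' hvm
  rw [Finset.sum_ite_eq]
  refine if_congr ?_ rfl rfl
  rw [Finset.mem_filter, mem_wordsOfType, this, eq_comm]

theorem mergeTypeSet_insert {t : ℕ+} {T : Finset ℕ+} (h : ∀ x ∈ T, t < x) (m : TypeVec) :
    mergeTypeSet (insert t T) m = mergeType t (mergeTypeSet T m) := by
  rw [mergeTypeSet, Finset.sort_insert _ (fun b hb => (h b hb).le) fun ht => (h t ht).false]
  rfl

omit [NeZero n] in
theorem mergeSet_insert {t : ℕ+} {T : Finset ℕ+} (h : ∀ x ∈ T, t < x) (u : Word n) :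
    mergeSet (insert t T) u = merge t (mergeSet T u) := by
  rw [mergeSet, Finset.sort_insert _ (fun b hb => (h b hb).le) fun ht => (h t ht).false]
  rfl

theorem wordType_mergeSet (T : Finset ℕ+) (u : Word n) :
    wordType (mergeSet T u) = mergeTypeSet T (wordType u) := by
  unfold mergeSet mergeTypeSet
  induction T.sort (· ≤ ·) with
  | nil => rfl
  | cons t L ih => rw [List.foldr_cons, wordType_merge, ih, List.foldr_cons]

theorem mergeTypeSet_apply_of_lt {T : Finset ℕ+} {j : ℕ+} (h : ∀ x ∈ T, j < x) (m : TypeVec) :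
    mergeTypeSet T m j = m j := by
  replace h : ∀ x ∈ T.sort (· ≤ ·), j < x := fun x hx => h x ((Finset.mem_sort _).1 hx)
  unfold mergeTypeSet
  generalize T.sort (· ≤ ·) = L at *
  induction L with
  | nil => rfl
  | cons t L ih =>
    rw [List.foldr_cons, mergeType, if_pos (h t (by simp))]
    exact ih fun x hx => h x (by simp [hx])

/-- The inequality is weak because it is needed at `t + 1`, which may itself belong to the set of
larger merged classes. -/
theorem mergeTypeSet_ne_zero {T : Finset ℕ+} {j : ℕ+} (h : ∀ x ∈ T, j ≤ x) {m : TypeVec}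
    (hm : m j ≠ 0) : mergeTypeSet T m j ≠ 0 := by
  replace h : ∀ x ∈ T.sort (· ≤ ·), j ≤ x := fun x hx => h x ((Finset.mem_sort _).1 hx)
  unfold mergeTypeSet
  generalize T.sort (· ≤ ·) = L at *
  induction L with
  | nil => exact hm
  | cons t L ih =>
    have := ih fun x hx => h x (by simp [hx])
    rw [List.foldr_cons, mergeType]
    rcases (h t (by simp)).eq_or_lt with rfl | hjt
    · rw [if_neg (lt_irrefl _), if_pos rfl]
      omega
    · rwa [if_pos hjt]

theorem spectralWeight_mul_prod_esymm (T : Finset ℕ+) (m : TypeVec) :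
    ∀ (_ : ∀ t ∈ T, m t ≠ 0 ∧ m (t + 1) ≠ 0) {v : Word n} (_ : IsPacked v)
      (_ : wordType v = mergeTypeSet T m),
    spectralWeight v * ∏ t ∈ T, MvPolynomial.esymm (ZMod n) ℤ (partialSum m t) =
      ∑ u ∈ (wordsOfType n m).filter (fun u => v = mergeSet T u), spectralWeight u := by
  -- The smallest element is merged last, so it acts on the already merged type, whose partial sum
  -- at `t` is still that of `m`.
  induction T using Finset.induction_on_min with
  | empty =>
    intro _ v _ hvm
    have : (wordsOfType n m).filter (fun u => v = mergeSet ∅ u) = {v} := by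
      ext u
      rw [Finset.mem_filter, mem_wordsOfType, Finset.mem_singleton]
      constructor
      · rintro ⟨-, h⟩
        rw [h]; simp [mergeSet]
      · rintro rfl
        rw [hvm]
        simp [mergeSet, mergeTypeSet]
    rw [this]
    simp
  | insert t T hlt ih =>
    intro hm v hv hvm
    have hT : ∀ x ∈ T, m x ≠ 0 ∧ m (x + 1) ≠ 0 := fun x hx => hm x (Finset.mem_insert_of_mem hx)
    obtain ⟨ht, ht'⟩ := hm t (Finset.mem_insert_self t T)
    rw [mergeTypeSet_insert hlt] at hvm
    have h1 := mergeTypeSet_ne_zero (fun x hx => (hlt x hx).le) ht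
    have h2 := mergeTypeSet_ne_zero (fun x hx => PNat.add_one_le_iff.2 (hlt x hx)) ht'
    have hp : partialSum m t = psum (mergeTypeSet T m) t := by
      rw [← partialSum_eq_psum]
      refine Finset.sum_congr rfl fun j hj => (mergeTypeSet_apply_of_lt (fun x hx => ?_) m).symm
      exact (Finset.mem_Icc.1 hj).2.trans_lt (hlt x hx)
    rw [Finset.prod_insert fun h => (hlt t h).false, ← mul_assoc, hp,
      spectralWeight_mul_esymm h1 h2 hv hvm, Finset.sum_mul]
    rw [Finset.sum_congr rfl fun w hw => by
      have hw' := mem_wordsOfType.1 (Finset.mem_filter.1 hw).1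
      exact ih hT (isPacked_of_mergeType h1 h2 hv hvm hw').1 hw']
    -- In the double sum the intermediate word `w` is determined by `u` as `mergeSet T u`.
    rw [Finset.sum_sigma']
    refine Finset.sum_bij' (fun x _ => x.2) (fun u _ => ⟨mergeSet T u, u⟩) ?_ ?_ ?_ ?_ ?_
    · rintro ⟨w, u⟩ h
      simp only [Finset.mem_sigma, Finset.mem_filter] at h
      obtain ⟨⟨-, h3⟩, h4, h5⟩ := h
      rw [Finset.mem_filter, mergeSet_insert hlt, ← h5]
      exact ⟨h4, h3⟩
    · intro u h
      rw [Finset.mem_filter, mergeSet_insert hlt, mem_wordsOfType] at h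
      simp only [Finset.mem_sigma, Finset.mem_filter, mem_wordsOfType]
      exact ⟨⟨by rw [wordType_mergeSet, h.1], h.2⟩, h.1, trivial⟩
    · rintro ⟨w, u⟩ h
      simp only [Finset.mem_sigma, Finset.mem_filter] at h
      obtain ⟨-, -, h5⟩ := h
      rw [h5]
    · intro u _; rfl
    · rintro ⟨w, u⟩ _; rfl

end SpectralWeight

end MLQ

theorem mainTheorem4 (n : ℕ) [NeZero n] (T : Finset ℕ+) (m : MLQ.TypeVec)
    (hm : ∀ t ∈ T, m t ≠ 0 ∧ m (t + 1) ≠ 0)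
    (v : MLQ.Word n) (hv : MLQ.IsPacked v) (hvm : MLQ.wordType v = MLQ.mergeTypeSet T m) :
    MLQ.spectralWeight v *
        ∏ t ∈ T, MvPolynomial.esymm (ZMod n) ℤ (MLQ.partialSum m t) =
      ∑ u ∈ (MLQ.wordsOfType n m).filter (fun u => v = MLQ.mergeSet T u),
        MLQ.spectralWeight u :=
  MLQ.spectralWeight_mul_prod_esymm T m hm hv hvm
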